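/- Let $Q$ be a plane quadrangulation, i.e. a finite simple connected plane graph in which every face (including the outer face $F_{\mathrm{out}}$) is bounded by a $4$-cycle. Fix its proper bipartition into black and white vertices so that the two black vertices on the outer face are named $s_0$ and $s_1$. An angle of $Q$ is a pair of clockwise consecutive edges at a vertex; each angle lies in one face. A strong labeling of $Q$ is a map from the angles of $Q$ to $\{0,1\}$ such that (G0) all angles at $s_i$ are labeled $i$ ($i=0,1$); (G1) around each vertex $v\notin\{s_0,s_1\}$ the labels form a non-empty (cyclic) interval of $0$s and a non-empty interval of $1$s; (G2) for each edge, the two labels incident with the edge at one endpoint coincide, and those at the other endpoint differ; (G3) the labels in each face are $0011$ cyclically, and the labels of the outer face, read clockwise starting at $s_0$, are $0,0,1,1$. A strong labeling induces an orientation of $Q$: each edge is oriented towards the endpoint where its two incident labels coincide. Given a strong labeling $\ell$ and a simple directed cycle $C$ of its induced orientation, the flip of $\ell$ at $C$ is the labeling obtained from $\ell$ by complementing all labels of angles in the faces inside $C$. The flip graph of $Q$ has the strong labelings of $Q$ as its vertices, two distinct strong labelings being adjacent if one arises from the other by a flip. Then: (1) for every strong labeling $\ell$ of $Q$ and every simple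 directed cycle $C$ of its induced orientation, the flip of $\ell$ at $C$ is again a strong labeling of $Q$, and its induced orientation is obtained from that of $\ell$ by reversing exactly the edges of $C$; (2) the flip graph of strong labelings of $Q$ is (non-empty and) connected. -/

import Mathlib

/-- A rotation system on a simple graph: for every dart (directed edge) `d`, the dart `cw d` is the
next one in clockwise order around the tail of `d`, and `cw` permutes the darts leaving each vertex
cyclically.  Together with `RotationSystem.IsPlane` this is a (combinatorial) plane graph. -/
structure RotationSystem {V : Type*} (G : SimpleGraph V) where
  cw : Equiv.Perm G.Dart
  cw_fst : ∀ d, (cw d).fst = d.fst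
  cyclic : ∀ d e : G.Dart, d.fst = e.fst → cw.SameCycle d e

namespace RotationSystem

variable {V : Type*} {G : SimpleGraph V} (R : RotationSystem G)

/-- The face permutation: `R.next d` is the dart that follows `d` on the boundary walk of the face
lying to the right of `d`.  Thus bounded faces are walked around clockwise.  (Arriving at the head
of `d` with the face on the right, one leaves along the dart that precedes the reversal of `d` in
clockwise order.) -/
def next : Equiv.Perm G.Dart :=
  (Function.Involutive.toPerm SimpleGraph.Dart.symm SimpleGraph.Dart.symm_involutive).trans
    R.cw.symm

/-- The faces: orbits of the face permutation. -/
def Face : Type _ := Quotient (Equiv.Perm.SameCycle.setoid R.next)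

/-- The face to the right of a dart. -/
def face (d : G.Dart) : R.Face := Quotient.mk (Equiv.Perm.SameCycle.setoid R.next) d

/-- The vertex `v` lies on the boundary of the face `f`. -/
def OnFace (v : V) (f : R.Face) : Prop := ∃ d : G.Dart, d.fst = v ∧ R.face d = f

/-- The rotation system describes a connected plane graph: the graph is connected and Euler's
formula holds, i.e. the embedding has genus `0`. -/
def IsPlane : Prop :=
  G.Connected ∧ (Nat.card V : ℤ) - (Nat.card G.edgeSet : ℤ) + (Nat.card R.Face : ℤ) = 2

/-- A plane quadrangulation: a (simple, connected) plane graph in which each face, including the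
outer one, is bounded by a cycle with four distinct vertices. -/
def IsQuadrangulation : Prop :=
  R.IsPlane ∧ ∀ d : G.Dart, (R.next ^ 4) d = d ∧
    Function.Injective fun i : Fin 4 => ((R.next ^ (i : ℕ)) d).fst

/-! ### Angle labelings

The angles of the plane graph are in bijection with the darts: the angle of a dart `d` lies at the
tail of `d`, between `d` and `R.cw d`, hence in the face `R.face d` to the right of `d`.
The two angles incident with `d` at its tail are those of `d` and of `R.cw.symm d`. -/

/-- The two labels incident with the edge of `d` at the tail of `d` coincide. -/
def Coincide (ℓ : G.Dart → Fin 2) (d : G.Dart) : Prop := ℓ d = ℓ (R.cw.symm d)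

/-- Strong labelings of a quadrangulation with outer face `outer` and special vertices `s 0`,
`s 1`. -/
structure IsStrongLabeling (outer : R.Face) (s : Fin 2 → V) (ℓ : G.Dart → Fin 2) : Prop where
  /-- All angles at `s i` are labeled `i`. -/
  special : ∀ i : Fin 2, ∀ d : G.Dart, d.fst = s i → ℓ d = i
  /-- Around any other vertex the labels form a non-empty interval of `0`s and a non-empty
  interval of `1`s. -/
  vertex_rule : ∀ v : V, (∀ i, v ≠ s i) → ∃ d : G.Dart, d.fst = v ∧
    ∃ k : ℕ, 0 < k ∧ k < Nat.card (G.neighborSet v) ∧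
      (∀ i < k, ℓ ((R.cw ^ i) d) = 0) ∧
      (∀ i, k ≤ i → i < Nat.card (G.neighborSet v) → ℓ ((R.cw ^ i) d) = 1)
  /-- The labels incident with an edge coincide at exactly one of its two ends. -/
  edge_rule : ∀ d : G.Dart, Xor (R.Coincide ℓ d) (R.Coincide ℓ d.symm)
  /-- The labels in each face are `0011` cyclically. -/
  face_rule : ∀ f : R.Face, ∃ d : G.Dart, R.face d = f ∧
    ℓ d = 0 ∧ ℓ (R.next d) = 0 ∧ ℓ ((R.next ^ 2) d) = 1 ∧ ℓ ((R.next ^ 3) d) = 1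
  /-- In the outer face, read clockwise starting at `s 0`, the labels are `0011`.  (`R.next` keeps
  the face on its right, hence runs counterclockwise around the outer boundary.) -/
  outer_rule : ∀ d : G.Dart, R.face d = outer → d.fst = s 0 →
    ℓ d = 0 ∧ ℓ (R.next.symm d) = 0 ∧
      ℓ ((R.next.symm ^ 2) d) = 1 ∧ ℓ ((R.next.symm ^ 3) d) = 1

/-- The orientation induced by a labeling: each edge is oriented towards the endpoint at which its
labels coincide.  `R.Directed ℓ d` says that the edge of `d` is oriented from the tail to the head
of `d`. -/
def Directed (ℓ : G.Dart → Fin 2) (d : G.Dart) : Prop :=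
  ¬ R.Coincide ℓ d ∧ R.Coincide ℓ d.symm

/-- `C` is a (simple) directed cycle of the orientation induced by `ℓ`. -/
def IsDirectedCycle (ℓ : G.Dart → Fin 2) {v : V} (C : G.Walk v v) : Prop :=
  C.IsCycle ∧ ∀ d ∈ C.darts, R.Directed ℓ d

/-- Two faces share an edge that does not belong to the set `S`. -/
def Across (S : Set (Sym2 V)) (f g : R.Face) : Prop :=
  ∃ d : G.Dart, d.edge ∉ S ∧ R.face d = f ∧ R.face d.symm = g

/-- A face is inside the cycle `C` if it cannot be reached from the outer face without crossing an
edge of `C`. -/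
def Inside (outer : R.Face) {v : V} (C : G.Walk v v) (f : R.Face) : Prop :=
  ¬ Relation.ReflTransGen (R.Across {e | e ∈ C.edges}) outer f

open Classical in
/-- Complementation of all labels inside the cycle `C`. -/
noncomputable def complementInside (outer : R.Face) {v : V} (C : G.Walk v v)
    (ℓ : G.Dart → Fin 2) : G.Dart → Fin 2 :=
  fun d => if R.Inside outer C (R.face d) then 1 - ℓ d else ℓ d

/-- The flip graph: its vertices are the strong labelings, and two of them are adjacent if they are
distinct and one arises from the other by a flip, i.e. by complementing all labels inside a
directed cycle of its induced orientation. -/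
def flipGraph (outer : R.Face) (s : Fin 2 → V) :
    SimpleGraph {ℓ : G.Dart → Fin 2 // R.IsStrongLabeling outer s ℓ} :=
  SimpleGraph.fromRel fun L M => ∃ (v : V) (C : G.Walk v v),
    R.IsDirectedCycle L.1 C ∧ M.1 = R.complementInside outer C L.1

end RotationSystem

/-! ### Darts, faces and connectivity of the map -/

namespace RotationSystem

variable {V : Type*} {G : SimpleGraph V} (R : RotationSystem G)

/-! Write the bipartition as a colouring `β` with values in `Fin 2`, black being `1`. The face, edge
and outer rules then collapse to one local equation, `ℓ (R.next d) = ℓ d + β d.fst`, while the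
special and vertex rules become conditions on the induced orientation: outdegree `0` at `s 0`, `s 1`
and `2` elsewhere. One label at `s 0` removes the remaining freedom of a global complement. This is
`IsAdmissible`; it is equivalent to being strong, and an admissible labeling is determined by its
orientation.

The topological input is `IsPlane.exists_boundary_eq`: on a plane map every edge set that is even at
each vertex is the boundary of a set of faces. It follows from a dimension count over `ZMod 2`,
where Euler's formula makes an inclusion of subspaces an equality. The Jordan curve theorem for
cycles, `IsPlane.xor_inside_of_mem_edges`, is a consequence. Complementing the inside of a directed
cycle therefore changes coincidence exactly at the edges of the cycle, that is, reverses it. A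
reversed directed cycle preserves outdegrees, and complementing whole faces preserves the local
equation, so flips stay admissible.

For connectivity, two admissible labelings have equal outdegrees, so the edges on which their
orientations disagree, if there are any, contain a directed cycle; flipping it strictly shrinks the
disagreement.

For existence, Hall's theorem assigns two edges to each non-special vertex. Its condition is the
sparsity bound that a vertex set `U` containing both special vertices induces at most `2|U| - 4`
edges. The resulting orientation is lifted to a labeling by correcting an arbitrary solution of the
local equation on a set of faces supplied by `IsPlane.exists_boundary_eq`. -/

theorem next_apply (d : G.Dart) : R.next d = R.cw.symm d.symm := rfl

theorem cw_symm_apply (d : G.Dart) : R.cw.symm d = R.next d.symm := by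
  rw [next_apply, SimpleGraph.Dart.symm_symm]

theorem cw_symm_fst (d : G.Dart) : (R.cw.symm d).fst = d.fst := by
  conv_rhs => rw [← R.cw.apply_symm_apply d, R.cw_fst]

theorem cw_pow_fst (i : ℕ) (d : G.Dart) : ((R.cw ^ i) d).fst = d.fst := by
  induction i with
  | zero => rfl
  | succ i ih => rw [pow_succ', Equiv.Perm.mul_apply, R.cw_fst, ih]

@[simp] theorem next_fst (d : G.Dart) : (R.next d).fst = d.snd := by
  rw [next_apply, cw_symm_fst]; rfl

theorem face_eq_iff {d e : G.Dart} : R.face d = R.face e ↔ R.next.SameCycle d e :=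
  Quotient.eq (r := Equiv.Perm.SameCycle.setoid R.next)

@[simp] theorem face_next (d : G.Dart) : R.face (R.next d) = R.face d :=
  R.face_eq_iff.2 (Equiv.Perm.sameCycle_apply_left.2 (Equiv.Perm.SameCycle.refl _ _))

theorem face_cw_symm (d : G.Dart) : R.face (R.cw.symm d) = R.face d.symm := by
  rw [cw_symm_apply, face_next]

theorem face_surjective : Function.Surjective R.face := Quotient.mk_surjective

instance [Finite G.Dart] : Finite R.Face :=
  Finite.of_surjective _ R.face_surjective

variable {R} in
-- Rotation reaches every dart at a vertex and reversal passes to the neighbour, so on a connected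
-- graph the two act transitively on darts. This turns local invariance into global constancy.
theorem eq_of_invariant (hG : G.Connected) {α : Type*} {h : G.Dart → α}
    (hsymm : ∀ d, h d.symm = h d) (hcw : ∀ d, h (R.cw d) = h d) (d e : G.Dart) : h d = h e := by
  have hpow : ∀ (i : ℕ) (d : G.Dart), h ((R.cw ^ i) d) = h d := by
    intro i d
    induction i with
    | zero => rfl
    | succ i ih => rw [pow_succ', Equiv.Perm.mul_apply, hcw, ih]
  have hvert : ∀ d e : G.Dart, d.fst = e.fst → h d = h e := by
    intro d e hde
    obtain ⟨i, hi⟩ := R.cyclic d e hde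
    cases i with
    | ofNat i => rw [← hi]; exact (hpow i d).symm
    | negSucc i =>
      have : d = (R.cw ^ (i + 1)) e := by
        rw [← hi, zpow_negSucc]
        exact (Equiv.apply_symm_apply _ _).symm
      rw [this, hpow]
  have hwalk : ∀ (u v : V) (p : G.Walk u v) (d e : G.Dart), d.fst = u → e.fst = v → h d = h e := by
    intro u v p
    induction p with
    | nil => intro d e hd he; exact hvert d e (hd.trans he.symm)
    | cons hadj p ih =>
      intro d e hd he
      have h1 := hvert d ⟨(_, _), hadj⟩ hd
      rw [h1, ← hsymm]
      exact ih _ _ rfl he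
  exact hwalk _ _ (hG.preconnected d.fst e.fst).some d e rfl rfl

variable {R} in
-- This is connectedness of the dual graph.
theorem face_function_eq (hG : G.Connected) {α : Type*} {f : R.Face → α}
    (h : ∀ d, f (R.face d.symm) = f (R.face d)) (x y : R.Face) : f x = f y := by
  obtain ⟨d, rfl⟩ := R.face_surjective x
  obtain ⟨e, rfl⟩ := R.face_surjective y
  refine eq_of_invariant (R := R) (h := fun d => f (R.face d)) hG h (fun d => ?_) d e
  have := R.face_cw_symm (R.cw d)
  rw [Equiv.symm_apply_apply] at this
  rw [← h, ← this]

theorem cw_symm_cw_pow_succ (i : ℕ) (d : G.Dart) :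
    R.cw.symm ((R.cw ^ (i + 1)) d) = (R.cw ^ i) d := by
  rw [pow_succ', Equiv.Perm.mul_apply, Equiv.symm_apply_apply]

/-! ### Rotation around a vertex -/

theorem ncard_darts_at (v : V) :
    {e : G.Dart | e.fst = v}.ncard = Nat.card (G.neighborSet v) := by
  rw [← Set.ncard_univ, ← Set.ncard_image_of_injective _ (G.dartOfNeighborSet_injective v)]
  congr 1
  ext e
  simp only [Set.mem_ofPred_eq, Set.image_univ, Set.mem_range]
  constructor
  · rintro rfl
    exact ⟨⟨e.snd, e.adj⟩, rfl⟩
  · rintro ⟨w, rfl⟩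
    rfl

section Finite

variable [Finite G.Dart]

theorem minimalPeriod_cw (d : G.Dart) :
    Function.minimalPeriod R.cw d = Nat.card (G.neighborSet d.fst) := by
  rw [← ncard_darts_at, ← Set.ncard_Iio_nat (Function.minimalPeriod R.cw d),
    ← Set.InjOn.ncard_image (f := fun i => R.cw^[i] d)]
  · congr 1
    ext e
    simp only [Set.mem_image, Set.mem_Iio, Set.mem_ofPred_eq]
    constructor
    · rintro ⟨i, -, rfl⟩
      rw [← Equiv.Perm.coe_pow]
      exact R.cw_pow_fst i d
    · intro he
      obtain ⟨i, hi⟩ := (R.cyclic d e he.symm).exists_nat_pow_eq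
      have hp : 0 < Function.minimalPeriod R.cw d :=
        Function.minimalPeriod_pos_of_mem_periodicPts
          (R.cw.injective.mem_periodicPts d)
      refine ⟨i % Function.minimalPeriod R.cw d, Nat.mod_lt _ hp, ?_⟩
      rw [Function.iterate_mod_minimalPeriod_eq, ← Equiv.Perm.coe_pow, hi]
  · exact Function.iterate_injOn_Iio_minimalPeriod

theorem exists_cw_pow_eq {d e : G.Dart} (h : e.fst = d.fst) :
    ∃ i < Nat.card (G.neighborSet d.fst), (R.cw ^ i) d = e := by
  obtain ⟨i, hi⟩ := (R.cyclic d e h.symm).exists_nat_pow_eq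
  have hp : 0 < Function.minimalPeriod R.cw d :=
    Function.minimalPeriod_pos_of_mem_periodicPts (R.cw.injective.mem_periodicPts d)
  rw [← R.minimalPeriod_cw]
  refine ⟨i % Function.minimalPeriod R.cw d, Nat.mod_lt _ hp, ?_⟩
  rw [Equiv.Perm.coe_pow, Function.iterate_mod_minimalPeriod_eq, ← Equiv.Perm.coe_pow, hi]

theorem cw_pow_inj {d : G.Dart} {i j : ℕ} (hi : i < Nat.card (G.neighborSet d.fst))
    (hj : j < Nat.card (G.neighborSet d.fst)) (h : (R.cw ^ i) d = (R.cw ^ j) d) : i = j := by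
  rw [← R.minimalPeriod_cw] at hi hj
  rw [Equiv.Perm.coe_pow, Equiv.Perm.coe_pow] at h
  exact Function.iterate_injOn_Iio_minimalPeriod hi hj h

theorem cw_pow_card (d : G.Dart) : (R.cw ^ Nat.card (G.neighborSet d.fst)) d = d := by
  rw [← R.minimalPeriod_cw, Equiv.Perm.coe_pow]
  exact Function.iterate_minimalPeriod

end Finite

/-! ### Outdegree two and the interval rule at a vertex -/

/-- The outdegree of `v` in the orientation induced by `ℓ`: the number of edges at `v` along which
the label changes at `v`. -/
noncomputable def outdeg (ℓ : G.Dart → Fin 2) (v : V) : ℕ :=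
  {d : G.Dart | d.fst = v ∧ ¬ R.Coincide ℓ d}.ncard

section Finite

variable [Finite G.Dart]

theorem label_eq_of_outdeg_eq_zero {ℓ : G.Dart → Fin 2} {v : V} (h : R.outdeg ℓ v = 0)
    {d e : G.Dart} (hd : d.fst = v) (he : e.fst = v) : ℓ d = ℓ e := by
  rw [outdeg, Set.ncard_eq_zero (Set.toFinite _)] at h
  have hco : ∀ d : G.Dart, d.fst = v → R.Coincide ℓ d := by
    intro d hd
    by_contra hn
    exact (h ▸ (⟨hd, hn⟩ : d ∈ {d : G.Dart | d.fst = v ∧ ¬ R.Coincide ℓ d}) :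
      d ∈ (∅ : Set G.Dart))
  obtain ⟨i, -, rfl⟩ := R.exists_cw_pow_eq (d := d) (e := e) (he.trans hd.symm)
  clear he
  induction i with
  | zero => rfl
  | succ i ih =>
    have := hco ((R.cw ^ (i + 1)) d) ((R.cw_pow_fst _ _).trans hd)
    rw [Coincide, cw_symm_cw_pow_succ] at this
    rw [ih, this]

/-- The label changes only at the starts of the two intervals, the darts `d` and `(R.cw ^ k) d`. -/
theorem outdeg_eq_two_of_intervals {ℓ : G.Dart → Fin 2} {d : G.Dart} {k : ℕ} (hk : 0 < k)
    (hkn : k < Nat.card (G.neighborSet d.fst)) (h0 : ∀ i < k, ℓ ((R.cw ^ i) d) = 0)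
    (h1 : ∀ i, k ≤ i → i < Nat.card (G.neighborSet d.fst) → ℓ ((R.cw ^ i) d) = 1) :
    R.outdeg ℓ d.fst = 2 := by
  have hset : {e : G.Dart | e.fst = d.fst ∧ ¬ R.Coincide ℓ e} = {d, (R.cw ^ k) d} := by
    ext e
    simp only [Set.mem_ofPred_eq, Set.mem_insert_iff, Set.mem_singleton_iff]
    constructor
    · rintro ⟨he, hn⟩
      obtain ⟨i, hi, rfl⟩ := R.exists_cw_pow_eq he
      rcases i with _ | i
      · left; rfl
      · rw [Coincide, cw_symm_cw_pow_succ] at hn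
        rcases lt_trichotomy (i + 1) k with hik | hik | hik
        · exact absurd ((h0 _ hik).trans (h0 _ (by omega)).symm) hn
        · right; rw [hik]
        · exact absurd ((h1 _ hik.le hi).trans (h1 _ (by omega) (by omega)).symm) hn
    · rintro (rfl | rfl)
      · refine ⟨rfl, fun hc => ?_⟩
        -- Wrap around: the predecessor of the first dart is the last one, at index degree minus
        -- one, which lies in the interval of `1`s.
        obtain ⟨n, hn⟩ : ∃ n, Nat.card (G.neighborSet e.fst) = n + 1 :=
          ⟨_, (Nat.succ_pred_eq_of_pos (by omega)).symm⟩
        have hcard := R.cw_pow_card e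
        rw [hn] at hcard
        have h2 := R.cw_symm_cw_pow_succ n e
        rw [hcard] at h2
        rw [Coincide, h2, h1 n (by omega) (by omega)] at hc
        have := h0 0 hk
        rw [pow_zero, Equiv.Perm.one_apply, hc] at this
        exact absurd this (by decide)
      · refine ⟨R.cw_pow_fst _ _, fun hc => ?_⟩
        obtain ⟨m, rfl⟩ : ∃ m, k = m + 1 := ⟨_, (Nat.succ_pred_eq_of_pos hk).symm⟩
        rw [Coincide, cw_symm_cw_pow_succ, h0 m (by omega), h1 _ le_rfl hkn] at hc
        exact absurd hc (by decide)
  rw [outdeg, hset, Set.ncard_pair]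
  intro h
  have := R.cw_pow_inj (d := d) (i := 0) (j := k) (by omega) hkn h
  omega

theorem exists_intervals_of_outdeg_eq_two {ℓ : G.Dart → Fin 2} {v : V}
    (h : R.outdeg ℓ v = 2) : ∃ d : G.Dart, d.fst = v ∧
      ∃ k : ℕ, 0 < k ∧ k < Nat.card (G.neighborSet v) ∧
      (∀ i < k, ℓ ((R.cw ^ i) d) = 0) ∧
      (∀ i, k ≤ i → i < Nat.card (G.neighborSet v) → ℓ ((R.cw ^ i) d) = 1) := by
  obtain ⟨a, b, hab, hset⟩ := Set.ncard_eq_two.1 h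
  -- The two changes cut the rotation into two constant arcs. Either arc may be the one labeled `0`,
  -- so the claim is kept symmetric and used from both starting darts.
  have key : ∀ a b : G.Dart, a ≠ b →
      {d : G.Dart | d.fst = v ∧ ¬ R.Coincide ℓ d} = {a, b} →
      ∃ k : ℕ, 0 < k ∧ k < Nat.card (G.neighborSet v) ∧ a.fst = v ∧ ℓ a ≠ ℓ b ∧
      (∀ i < k, ℓ ((R.cw ^ i) a) = ℓ a) ∧
      (∀ i, k ≤ i → i < Nat.card (G.neighborSet v) → ℓ ((R.cw ^ i) a) = ℓ b) := by
    intro a b hab hset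
    have ha : a.fst = v ∧ ¬ R.Coincide ℓ a :=
      (hset ▸ (by simp) : a ∈ {d : G.Dart | d.fst = v ∧ ¬ R.Coincide ℓ d})
    have hb : b.fst = v ∧ ¬ R.Coincide ℓ b :=
      (hset ▸ (by simp) : b ∈ {d : G.Dart | d.fst = v ∧ ¬ R.Coincide ℓ d})
    obtain ⟨hav, -⟩ := ha
    subst hav
    obtain ⟨k, hk, rfl⟩ := R.exists_cw_pow_eq (d := a) (e := b) hb.1
    have hk0 : k ≠ 0 := by rintro rfl; exact hab rfl
    have hco : ∀ i, 0 < i → i < Nat.card (G.neighborSet a.fst) → i ≠ k →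
        R.Coincide ℓ ((R.cw ^ i) a) := by
      intro i hi0 hin hik
      by_contra hn
      have hmem : (R.cw ^ i) a ∈ ({a, (R.cw ^ k) a} : Set G.Dart) :=
        hset ▸ ⟨R.cw_pow_fst _ _, hn⟩
      rcases hmem with hmem | hmem
      · have := R.cw_pow_inj (d := a) (i := i) (j := 0) hin (by omega) hmem
        omega
      · exact hik (R.cw_pow_inj hin hk hmem)
    have hlow : ∀ i < k, ℓ ((R.cw ^ i) a) = ℓ a := by
      intro i hi
      induction i with
      | zero => rfl
      | succ i ih =>
        have := hco (i + 1) (by omega) (by omega) (by omega)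
        rw [Coincide, cw_symm_cw_pow_succ] at this
        rw [this, ih (by omega)]
    refine ⟨k, by omega, hk, rfl, ?_, hlow, ?_⟩
    · obtain ⟨m, rfl⟩ : ∃ m, k = m + 1 := ⟨_, (Nat.succ_pred_eq_of_ne_zero hk0).symm⟩
      have := hb.2
      rw [Coincide, cw_symm_cw_pow_succ, hlow m (by omega)] at this
      exact fun h => this h.symm
    · intro i hki hin
      induction i, hki using Nat.le_induction with
      | base => rfl
      | succ i hi ih =>
        have := hco (i + 1) (by omega) hin (by omega)
        rw [Coincide, cw_symm_cw_pow_succ] at this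
        rw [this, ih (by omega)]
  obtain ⟨k, hk0, hk, ha, hne, hlow, hhigh⟩ := key a b hab hset
  obtain ⟨k', hk0', hk', hb, -, hlow', hhigh'⟩ := key b a hab.symm (by rw [hset, Set.pair_comm])
  have hfin : ∀ x y : Fin 2, x ≠ y → (x = 0 ∧ y = 1) ∨ (y = 0 ∧ x = 1) := by decide
  rcases hfin _ _ hne with ⟨h0, h1⟩ | ⟨h0, h1⟩
  · exact ⟨a, ha, k, hk0, hk, fun i hi => (hlow i hi).trans h0,
      fun i h2 h3 => (hhigh i h2 h3).trans h1⟩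
  · exact ⟨b, hb, k', hk0', hk', fun i hi => (hlow' i hi).trans h0,
      fun i h2 h3 => (hhigh' i h2 h3).trans h1⟩

end Finite

end RotationSystem

/-! ### Even edge sets and boundaries of face sets modulo 2 -/

namespace RotationSystem

variable {V : Type*} {G : SimpleGraph V} (R : RotationSystem G)

/-- A symmetric set of darts, i.e. a set of edges, with an even number of edges at each vertex. -/
structure IsEvenDartSet (D : Set G.Dart) : Prop where
  symm_mem : ∀ d, d.symm ∈ D ↔ d ∈ D
  even : ∀ v, Even {d | d ∈ D ∧ d.fst = v}.ncard

/-- The darts whose edge separates the set of faces `F` from its complement. -/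
def boundary (F : Set R.Face) : Set G.Dart := {d | Xor (R.face d ∈ F) (R.face d.symm ∈ F)}

theorem symm_mem_boundary (F : Set R.Face) (d : G.Dart) :
    d.symm ∈ R.boundary F ↔ d ∈ R.boundary F := by
  change Xor _ _ ↔ Xor _ _
  rw [SimpleGraph.Dart.symm_symm, xor_comm]

theorem ncard_filter_edges_at [Finite V] {D : Set G.Dart} (hD : ∀ d, d.symm ∈ D ↔ d ∈ D) (v : V) :
    {e : G.edgeSet | v ∈ e.1 ∧ ∃ d ∈ D, d.edge = e.1}.ncard = {d | d ∈ D ∧ d.fst = v}.ncard := by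
  rw [← Set.InjOn.ncard_image (f := fun d : G.Dart => (⟨d.edge, d.edge_mem⟩ : G.edgeSet))
    (s := {d | d ∈ D ∧ d.fst = v})]
  · congr 1
    ext ⟨e, he⟩
    simp only [Set.mem_ofPred_eq, Set.mem_image, Subtype.mk.injEq]
    constructor
    · rintro ⟨hv, d, hd, rfl⟩
      rcases Sym2.mem_iff.1 hv with h | h
      · exact ⟨d, ⟨hd, h.symm⟩, rfl⟩
      · exact ⟨d.symm, ⟨(hD d).2 hd, h.symm⟩, d.edge_symm⟩
    · rintro ⟨d, ⟨hd, rfl⟩, rfl⟩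
      exact ⟨Sym2.mem_mk_left _ _, d, hd, rfl⟩
  · rintro d ⟨-, hd⟩ e ⟨-, he⟩ h
    rcases SimpleGraph.dart_edge_eq_iff d e |>.1 (Subtype.mk.inj h) with h | h
    · exact h
    · rw [h] at hd
      exact absurd (hd.trans he.symm) e.snd_ne_fst

theorem exists_edge_eq_iff {D : Set G.Dart} (hD : ∀ d, d.symm ∈ D ↔ d ∈ D) (d : G.Dart) :
    (∃ d' ∈ D, d'.edge = d.edge) ↔ d ∈ D := by
  constructor
  · rintro ⟨d', hd', h⟩
    rcases (SimpleGraph.dart_edge_eq_iff _ _).1 h with rfl | rfl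
    · exact hd'
    · exact (hD _).1 hd'
  · exact fun h => ⟨d, h, rfl⟩

theorem exists_dart_of_mem_edgeSet (e : G.edgeSet) : ∃ d : G.Dart, d.edge = e.1 := by
  obtain ⟨e, he⟩ := e
  induction e with
  | _ u v => exact ⟨⟨(u, v), he⟩, rfl⟩

section Chains

theorem zmod_two_add_eq_one {x y : ZMod 2} : x + y = 1 ↔ Xor (x = 1) (y = 1) := by
  unfold Xor; revert x y; decide

/-- The incidence matrix modulo `2` of a set of edges `S` against a set of vertices `U`. -/
noncomputable def incidence (U : Set V) (S : Set G.edgeSet) : Matrix U S (ZMod 2) :=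
  open Classical in fun v e => if v.1 ∈ e.1.1 then 1 else 0

theorem incidence_of_mem {U : Set V} {S : Set G.edgeSet} {v : U} {e : S} (h : v.1 ∈ e.1.1) :
    incidence U S v e = 1 := if_pos h

theorem incidence_of_notMem {U : Set V} {S : Set G.edgeSet} {v : U} {e : S} (h : v.1 ∉ e.1.1) :
    incidence U S v e = 0 := if_neg h

theorem zmod_two_ne_zero {x : ZMod 2} : x ≠ 0 ↔ x = 1 := by
  revert x; decide

theorem zmod_two_add_eq_zero {x y : ZMod 2} : x + y = 0 ↔ x = y := by
  revert x y; decide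

theorem incidence_mulVec [Finite V] (U : Set V) (S : Set G.edgeSet) [Fintype S]
    (x : S → ZMod 2) (v : U) :
    (incidence U S).mulVec x v = ({e : S | v.1 ∈ e.1.1 ∧ x e = 1}.ncard : ZMod 2) := by
  classical
  rw [Set.ncard_eq_toFinset_card', Matrix.mulVec, dotProduct]
  have : ∀ e : S, incidence U S v e * x e = if v.1 ∈ e.1.1 ∧ x e = 1 then 1 else 0 := by
    intro e
    rw [incidence]
    by_cases h : v.1 ∈ e.1.1
    · by_cases hx : x e = 1
      · simp [h, hx]
      · have : x e = 0 := by
          by_contra h0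
          exact hx (zmod_two_ne_zero.1 h0)
        simp [h, this]
    · simp [h]
  rw [Finset.sum_congr rfl fun e _ => this e, Finset.sum_boole]
  congr 2
  ext e
  simp

theorem incidence_transpose_mulVec [Finite V] (U : Set V) (S : Set G.edgeSet) [Fintype U]
    (hS : ∀ e ∈ S, ∀ v ∈ e.1, v ∈ U)
    (g : U → ZMod 2) (d : G.Dart) (hd : ⟨d.edge, d.edge_mem⟩ ∈ S) :
    (incidence U S).transpose.mulVec g ⟨⟨d.edge, d.edge_mem⟩, hd⟩ =
      g ⟨d.fst, hS _ hd _ (Sym2.mem_mk_left _ _)⟩ +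
      g ⟨d.snd, hS _ hd _ (Sym2.mem_mk_right _ _)⟩ := by
  classical
  rw [Matrix.mulVec, dotProduct, ← Finset.sum_subset (Finset.subset_univ
    {⟨d.fst, hS _ hd _ (Sym2.mem_mk_left _ _)⟩, ⟨d.snd, hS _ hd _ (Sym2.mem_mk_right _ _)⟩})]
  · rw [Finset.sum_pair]
    · rw [Matrix.transpose_apply, Matrix.transpose_apply, incidence_of_mem, incidence_of_mem]
      · simp
      · exact Sym2.mem_mk_right _ _
      · exact Sym2.mem_mk_left _ _
    · intro h
      exact d.fst_ne_snd (Subtype.mk.inj h)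
  · intro v _ hv
    rw [Matrix.transpose_apply, incidence_of_notMem, zero_mul]
    intro h
    apply hv
    rcases Sym2.mem_iff.1 h with h | h
    · simp [Subtype.ext_iff, h]
    · simp [Subtype.ext_iff, h]

/-- Rank-nullity for the matrix and its transpose, which have equal rank: the cycle space has
dimension edges minus vertices plus components. -/
theorem finrank_ker_incidence [Finite V] (U : Set V) (S : Set G.edgeSet) [Fintype U] [Fintype S] :
    Module.finrank (ZMod 2) (LinearMap.ker (incidence U S).mulVecLin) + Nat.card U =
    Nat.card S + Module.finrank (ZMod 2) (LinearMap.ker (incidence U S).transpose.mulVecLin) := by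
  have h1 := (incidence U S).mulVecLin.finrank_range_add_finrank_ker
  have h2 := (incidence U S).transpose.mulVecLin.finrank_range_add_finrank_ker
  have h3 := (incidence U S).rank_transpose
  rw [Matrix.rank, Matrix.rank] at h3
  rw [Module.finrank_pi] at h1 h2
  rw [Nat.card_eq_fintype_card, Nat.card_eq_fintype_card]
  omega

/-- The boundary map modulo `2` from functions on a quotient of the set of faces to functions on a
set of edges. -/
noncomputable def coboundary {Q : Type*} (q : R.Face → Q) (S : Set G.edgeSet) :
    (Q → ZMod 2) →ₗ[ZMod 2] (S → ZMod 2) where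
  toFun f e := f (q (R.face (exists_dart_of_mem_edgeSet e.1).choose)) +
    f (q (R.face (exists_dart_of_mem_edgeSet e.1).choose.symm))
  map_add' f g := by ext e; simp only [Pi.add_apply]; ring
  map_smul' a f := by ext e; simp only [Pi.smul_apply, smul_eq_mul, RingHom.id_apply]; ring

/-- The dart chosen in the definition is irrelevant, since reversing it only swaps the summands. -/
theorem coboundary_apply {Q : Type*} (q : R.Face → Q) (S : Set G.edgeSet) (f : Q → ZMod 2)
    (d : G.Dart) (hd : ⟨d.edge, d.edge_mem⟩ ∈ S) :
    R.coboundary q S f ⟨⟨d.edge, d.edge_mem⟩, hd⟩ =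
      f (q (R.face d)) + f (q (R.face d.symm)) := by
  have h := (exists_dart_of_mem_edgeSet (⟨d.edge, d.edge_mem⟩ : G.edgeSet)).choose_spec
  change f (q (R.face (exists_dart_of_mem_edgeSet (⟨d.edge, d.edge_mem⟩ : G.edgeSet)).choose)) +
    f (q (R.face (exists_dart_of_mem_edgeSet (⟨d.edge, d.edge_mem⟩ : G.edgeSet)).choose.symm)) = _
  rcases (SimpleGraph.dart_edge_eq_iff _ _).1 h with h | h
  · rw [h]
  · rw [h, SimpleGraph.Dart.symm_symm, add_comm]

/-- A two-valued function on a cyclic sequence changes value an even number of times: modulo `2`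
each change is a sum of consecutive labels, and the total cancels after reindexing by `R.cw`. -/
theorem even_outdeg [Finite V] (ℓ : G.Dart → Fin 2) (v : V) : Even (R.outdeg ℓ v) := by
  classical
  have := Fintype.ofFinite V
  rw [outdeg, ← ZMod.natCast_eq_zero_iff_even, Set.ncard_eq_toFinset_card']
  let φ : G.Dart → ZMod 2 := ℓ
  have key : ∀ d : G.Dart, (if ¬ R.Coincide ℓ d then (1 : ZMod 2) else 0) =
      φ d + φ (R.cw.symm d) := by
    intro d
    have hco : R.Coincide ℓ d ↔ φ d = φ (R.cw.symm d) := Iff.rfl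
    by_cases h : φ d = φ (R.cw.symm d)
    · rw [if_neg (not_not.2 (hco.2 h)), zmod_two_add_eq_zero.2 h]
    · rw [if_pos (fun hc => h (hco.1 hc))]
      clear hco
      generalize φ d = x, φ (R.cw.symm d) = y at *
      revert x y
      decide
  have h1 : ({d | d.fst = v ∧ ¬ R.Coincide ℓ d} : Set G.Dart).toFinset =
      (Finset.univ.filter fun d : G.Dart => d.fst = v).filter fun d => ¬ R.Coincide ℓ d := by
    ext d
    simp
  rw [h1, ← Finset.sum_boole, Finset.sum_congr rfl fun d _ => key d, Finset.sum_add_distrib,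
    zmod_two_add_eq_zero]
  refine Finset.sum_bij' (fun d _ => R.cw d) (fun d _ => R.cw.symm d) ?_ ?_ ?_ ?_ ?_
  · intro d hd
    simpa [R.cw_fst] using hd
  · intro d hd
    simpa [R.cw_symm_fst] using hd
  · intro d _; simp
  · intro d _; simp
  · intro d _; simp

/-- Label each angle by whether its face lies in `F`; the boundary darts at `v` are those where this
label changes, so `even_outdeg` applies. -/
theorem isEvenDartSet_boundary [Finite V] (F : Set R.Face) : IsEvenDartSet (R.boundary F) := by
  classical
  refine ⟨R.symm_mem_boundary F, fun v => ?_⟩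
  convert R.even_outdeg (fun d => if R.face d ∈ F then 1 else 0) v using 1
  rw [outdeg]
  congr 1
  ext d
  simp only [Set.mem_ofPred_eq, boundary, Coincide, face_cw_symm]
  rw [and_comm]
  by_cases h1 : R.face d ∈ F <;> by_cases h2 : R.face d.symm ∈ F <;> simp [h1, h2, Xor]

variable {R}

/-- On a plane graph, every even set of edges separates some set of faces from its complement. -/
theorem IsPlane.exists_boundary_eq [Finite V] (hR : R.IsPlane) {D : Set G.Dart}
    (hD : IsEvenDartSet D) : ∃ F : Set R.Face, R.boundary F = D := by
  classical
  have := Fintype.ofFinite V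
  have := Fintype.ofFinite R.Face
  obtain ⟨hconn, heuler⟩ := hR
  set A := (incidence (G := G) Set.univ Set.univ).mulVecLin with hA
  set B := R.coboundary id Set.univ with hB
  have hle : LinearMap.range B ≤ LinearMap.ker A := by
    rintro _ ⟨f, rfl⟩
    rw [LinearMap.mem_ker]
    ext v
    rw [hA, Matrix.mulVecLin_apply, incidence_mulVec, Pi.zero_apply,
      ZMod.natCast_eq_zero_iff_even]
    convert (R.isEvenDartSet_boundary {x | f x = 1}).even v.1 using 1
    rw [← ncard_filter_edges_at (R.symm_mem_boundary _),
      ← Set.ncard_image_of_injective _ (Subtype.val_injective (p := fun e => e ∈ Set.univ))]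
    congr 1
    ext e
    obtain ⟨d, hd⟩ := exists_dart_of_mem_edgeSet e
    obtain ⟨e, he⟩ := e
    dsimp only at hd
    subst hd
    have hval := R.coboundary_apply id Set.univ f d (Set.mem_univ _)
    have hb : d ∈ R.boundary {x | f x = 1} ↔ B f ⟨⟨d.edge, d.edge_mem⟩, Set.mem_univ _⟩ = 1 := by
      rw [hB, hval, zmod_two_add_eq_one]; rfl
    simp only [Set.mem_image, Set.mem_ofPred_eq]
    rw [exists_edge_eq_iff (R.symm_mem_boundary _), hb]
    constructor
    · rintro ⟨⟨e', _⟩, h, rfl⟩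
      exact h
    · intro h
      exact ⟨⟨⟨d.edge, d.edge_mem⟩, Set.mem_univ _⟩, h, rfl⟩
  have hkerB : Module.finrank (ZMod 2) (LinearMap.ker B) ≤ 1 := by
    refine (Submodule.finrank_mono (t := Submodule.span (ZMod 2) {fun _ => 1}) ?_).trans
      ((finrank_span_le_card _).trans (by simp))
    intro f hf
    have hconst := face_function_eq (R := R) hconn (f := f) (fun d => by
      have := R.coboundary_apply id Set.univ f d (Set.mem_univ _)
      rw [← hB, LinearMap.mem_ker.1 hf] at this
      exact (zmod_two_add_eq_zero.1 this.symm).symm)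
    rw [Submodule.mem_span_singleton]
    rcases isEmpty_or_nonempty R.Face with h | ⟨⟨x⟩⟩
    · exact ⟨0, funext fun y => (h.false y).elim⟩
    · exact ⟨f x, funext fun y => by simp [hconst y x]⟩
  have hkerA : Module.finrank (ZMod 2)
      (LinearMap.ker (incidence (G := G) Set.univ Set.univ).transpose.mulVecLin) ≤ 1 := by
    refine (Submodule.finrank_mono (t := Submodule.span (ZMod 2) {fun _ => 1}) ?_).trans
      ((finrank_span_le_card _).trans (by simp))
    intro g hg
    have hadj : ∀ u v, G.Adj u v → g ⟨u, Set.mem_univ _⟩ = g ⟨v, Set.mem_univ _⟩ := by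
      intro u v huv
      have := incidence_transpose_mulVec (G := G) Set.univ Set.univ (fun _ _ _ _ => Set.mem_univ _)
        g ⟨(u, v), huv⟩ (Set.mem_univ _)
      rw [← Matrix.mulVecLin_apply, LinearMap.mem_ker.1 hg] at this
      exact zmod_two_add_eq_zero.1 this.symm
    have hwalk : ∀ u v, G.Walk u v → g ⟨u, Set.mem_univ _⟩ = g ⟨v, Set.mem_univ _⟩ := by
      intro u v p
      induction p with
      | nil => rfl
      | cons h p ih => exact (hadj _ _ h).trans ih
    rw [Submodule.mem_span_singleton]
    obtain ⟨v⟩ := hconn.nonempty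
    refine ⟨g ⟨v, Set.mem_univ _⟩, funext fun y => ?_⟩
    simpa using hwalk v y.1 (hconn.preconnected v y.1).some
  have hrank := finrank_ker_incidence (G := G) Set.univ Set.univ
  have hrankB := B.finrank_range_add_finrank_ker
  rw [Module.finrank_pi] at hrankB
  rw [Nat.card_eq_fintype_card (α := R.Face)] at heuler
  rw [Nat.card_coe_set_eq, Set.ncard_univ, Nat.card_coe_set_eq, Set.ncard_univ, ← hA] at hrank
  -- With `V`, `E`, `F` denoting the numbers of vertices, edges and faces: `dim ker A ≤ E - V + 1 =
  -- F - 1 ≤ dim range B`, the equality being Euler's formula and the outer bounds coming from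
  -- `hkerA` and `hkerB`.
  have heq : LinearMap.range B = LinearMap.ker A := by
    apply Submodule.eq_of_le_of_finrank_le hle
    omega
  let x : ↥(Set.univ : Set G.edgeSet) → ZMod 2 := fun e => if ∃ d ∈ D, d.edge = e.1.1 then 1 else 0
  have hx : x ∈ LinearMap.ker A := by
    rw [LinearMap.mem_ker]
    ext v
    rw [hA, Matrix.mulVecLin_apply, incidence_mulVec, Pi.zero_apply,
      ZMod.natCast_eq_zero_iff_even]
    convert hD.even v.1 using 1
    rw [← ncard_filter_edges_at hD.symm_mem,
      ← Set.ncard_image_of_injective _ (Subtype.val_injective (p := fun e => e ∈ Set.univ))]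
    congr 1
    ext e
    simp [x]
  rw [← heq] at hx
  obtain ⟨f, hf⟩ := hx
  refine ⟨{y | f y = 1}, ?_⟩
  ext d
  have hval := R.coboundary_apply id Set.univ f d (Set.mem_univ _)
  change Xor (f (R.face d) = 1) (f (R.face d.symm) = 1) ↔ d ∈ D
  rw [← zmod_two_add_eq_one]
  change f (id (R.face d)) + f (id (R.face d.symm)) = 1 ↔ d ∈ D
  rw [← hval, ← hB, hf]
  simp only [x]
  rw [← exists_edge_eq_iff hD.symm_mem d]
  split_ifs with h
  · simp [h]
  · simp [h]

end Chains

end RotationSystem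

namespace RotationSystem

variable {V : Type*} {G : SimpleGraph V} {R : RotationSystem G}

/-! ### Cycles separate the faces into inside and outside -/

theorem ncard_darts_of_isCycle {v : V} {C : G.Walk v v} (hC : C.IsCycle) {w : V}
    (hw : w ∈ C.support) : {d : G.Dart | d.edge ∈ C.edges ∧ d.fst = w}.ncard = 2 := by
  rw [← hC.ncard_neighborSet_toSubgraph_eq_two hw,
    ← Set.InjOn.ncard_image (f := fun d : G.Dart => d.snd)]
  · congr 1
    ext x
    simp only [Set.mem_image, Set.mem_ofPred_eq, SimpleGraph.Subgraph.mem_neighborSet,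
      SimpleGraph.Walk.adj_toSubgraph_iff_mem_edges]
    constructor
    · rintro ⟨d, ⟨hd, rfl⟩, rfl⟩
      exact hd
    · intro h
      exact ⟨⟨(w, x), C.adj_of_mem_edges h⟩, ⟨h, rfl⟩, rfl⟩
  · rintro d ⟨-, hd⟩ e ⟨-, he⟩ h
    exact SimpleGraph.Dart.ext _ _ (Prod.ext (hd.trans he.symm) h)

theorem isEvenDartSet_of_isCycle {v : V} {C : G.Walk v v} (hC : C.IsCycle) :
    IsEvenDartSet {d : G.Dart | d.edge ∈ C.edges} := by
  refine ⟨fun d => ?_, fun w => ?_⟩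
  · change d.symm.edge ∈ C.edges ↔ d.edge ∈ C.edges
    rw [SimpleGraph.Dart.edge_symm]
  · by_cases hw : w ∈ C.support
    · change Even {d : G.Dart | d.edge ∈ C.edges ∧ d.fst = w}.ncard
      rw [ncard_darts_of_isCycle hC hw]
      exact even_two
    · suffices h : {d : G.Dart | d.edge ∈ C.edges ∧ d.fst = w} = ∅ by
        change Even {d : G.Dart | d.edge ∈ C.edges ∧ d.fst = w}.ncard
        rw [h, Set.ncard_empty]
        exact Even.zero
      ext d
      simp only [Set.mem_ofPred_eq, Set.mem_empty_iff_false, iff_false, not_and]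
      rintro hd rfl
      exact hw (C.fst_mem_support_of_mem_edges hd)

theorem iff_start_of_mem_support {P : V → Prop} {u v : V} (p : G.Walk u v)
    (h : ∀ d ∈ p.darts, P d.fst ↔ P d.snd) {w : V} (hw : w ∈ p.support) : P w ↔ P u := by
  induction p with
  | nil =>
    rw [SimpleGraph.Walk.support_nil, List.mem_singleton] at hw
    rw [hw]
  | cons hadj p ih =>
    rw [SimpleGraph.Walk.support_cons, List.mem_cons] at hw
    rw [SimpleGraph.Walk.darts_cons] at h
    rcases hw with rfl | hw
    · rfl
    · rw [ih (fun d hd => h d (List.mem_cons_of_mem _ hd)) hw]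
      exact (h _ List.mem_cons_self).symm

/-- A nonempty even set of edges of a cycle consists of all its edges. -/
theorem IsEvenDartSet.eq_of_subset_cycle [Finite V] {v : V} {C : G.Walk v v} (hC : C.IsCycle)
    {D : Set G.Dart} (hD : IsEvenDartSet D) (hsub : D ⊆ {d | d.edge ∈ C.edges})
    (hne : D.Nonempty) : D = {d | d.edge ∈ C.edges} := by
  have := Fintype.ofFinite V
  classical
  -- At a vertex met by `D`, an even positive number of the two cycle edges lies in `D`, hence both
  -- do. The property `P` then spreads along the cycle.
  let P : V → Prop := fun w => ∀ d : G.Dart, d.edge ∈ C.edges → d.fst = w → d ∈ D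
  have hP : ∀ d ∈ D, P d.fst := by
    intro d hd e he hed
    have hsub' : {x | x ∈ D ∧ x.fst = d.fst} ⊆ {x : G.Dart | x.edge ∈ C.edges ∧ x.fst = d.fst} :=
      fun x hx => ⟨hsub hx.1, hx.2⟩
    have h2 := ncard_darts_of_isCycle hC (C.fst_mem_support_of_mem_edges (hsub hd))
    have hpos : 0 < {x | x ∈ D ∧ x.fst = d.fst}.ncard :=
      (Set.ncard_pos (Set.toFinite _)).2 ⟨d, hd, rfl⟩
    have heven := hD.even d.fst
    have heq := Set.eq_of_subset_of_ncard_le hsub' (by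
      obtain ⟨m, hm⟩ := heven
      omega) (Set.toFinite _)
    have : e ∈ {x | x ∈ D ∧ x.fst = d.fst} := heq ▸ ⟨he, hed⟩
    exact this.1
  have hstep : ∀ d ∈ C.darts, P d.fst ↔ P d.snd := by
    intro d hd
    have hde : d.edge ∈ C.edges := List.mem_map_of_mem hd
    constructor
    · intro h
      exact hP d.symm ((hD.symm_mem d).2 (h d hde rfl))
    · intro h
      exact hP d ((hD.symm_mem d).1 (h d.symm (by rwa [SimpleGraph.Dart.edge_symm]) rfl))
  obtain ⟨d, hd⟩ := hne
  have hPv : P v :=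
    (iff_start_of_mem_support C hstep (C.fst_mem_support_of_mem_edges (hsub hd))).1 (hP d hd)
  refine hsub.antisymm fun e he => ?_
  exact (iff_start_of_mem_support C hstep (C.fst_mem_support_of_mem_edges he)).2 hPv e he rfl

theorem across_symm {S : Set (Sym2 V)} {x y : R.Face} (h : R.Across S x y) : R.Across S y x := by
  obtain ⟨d, hd, rfl, rfl⟩ := h
  exact ⟨d.symm, by rwa [SimpleGraph.Dart.edge_symm], rfl, by rw [SimpleGraph.Dart.symm_symm]⟩

theorem not_inside_outer (outer : R.Face) {v : V} (C : G.Walk v v) : ¬ R.Inside outer C outer :=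
  fun h => h Relation.ReflTransGen.refl

theorem inside_iff_of_notMem_edges {outer : R.Face} {v : V} {C : G.Walk v v} {d : G.Dart}
    (hd : d.edge ∉ C.edges) : R.Inside outer C (R.face d) ↔ R.Inside outer C (R.face d.symm) := by
  have h : R.Across {e | e ∈ C.edges} (R.face d) (R.face d.symm) := ⟨d, hd, rfl, rfl⟩
  exact not_congr ⟨fun h' => h'.tail h, fun h' => h'.tail (across_symm h)⟩

/-- The Jordan curve theorem: each edge of a cycle has exactly one of its two sides inside. -/
theorem IsPlane.xor_inside_of_mem_edges [Finite V] (hR : R.IsPlane) (outer : R.Face) {v : V}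
    {C : G.Walk v v} (hC : C.IsCycle) {d : G.Dart} (hd : d.edge ∈ C.edges) :
    Xor (R.Inside outer C (R.face d)) (R.Inside outer C (R.face d.symm)) := by
  set T : Set R.Face := {x | R.Inside outer C x} with hT
  have hsub : R.boundary T ⊆ {d | d.edge ∈ C.edges} := by
    intro e he
    by_contra hn
    have := inside_iff_of_notMem_edges (R := R) (outer := outer) hn
    rcases he with ⟨h1, h2⟩ | ⟨h1, h2⟩
    · exact h2 (this.1 h1)
    · exact h2 (this.2 h1)
  by_cases hne : (R.boundary T).Nonempty
  · have := (R.isEvenDartSet_boundary T).eq_of_subset_cycle hC hsub hne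
    exact (this ▸ hd : d ∈ R.boundary T)
  -- If no edge separates inside from outside, every face is reachable from `outer` without crossing
  -- `C`. A set of faces with boundary `C` would then be everything or empty, contradicting that `d`
  -- is on its boundary.
  · exfalso
    have hconst : ∀ x, R.Inside outer C x ↔ R.Inside outer C outer := by
      intro x
      refine iff_of_eq (face_function_eq (R := R) hR.1 (f := R.Inside outer C) (fun e => ?_) _ _)
      by_contra h
      refine hne ⟨e, ?_⟩
      change Xor (R.Inside outer C _) (R.Inside outer C _)
      by_cases h1 : R.Inside outer C (R.face e) <;>
        by_cases h2 : R.Inside outer C (R.face e.symm) <;> simp_all [Xor]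
    obtain ⟨F, hF⟩ := hR.exists_boundary_eq (isEvenDartSet_of_isCycle hC)
    have hFT : ∀ x, x ∈ F ↔ outer ∈ F := by
      intro x
      have hx : Relation.ReflTransGen (R.Across {e | e ∈ C.edges}) outer x := by
        by_contra h
        exact not_inside_outer outer C ((hconst x).1 h)
      induction hx with
      | refl => rfl
      | tail _ h ih =>
        refine Iff.trans ?_ ih
        obtain ⟨e, he, rfl, rfl⟩ := h
        have hnb : e ∉ R.boundary F := hF ▸ he
        change ¬ Xor _ _ at hnb
        rw [not_xor] at hnb
        exact hnb.symm
    have : d ∈ R.boundary F := hF ▸ hd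
    change Xor _ _ at this
    rw [hFT, hFT (R.face d.symm)] at this
    exact (_root_.xor_self _ ▸ this :)

/-! ### Darts of closed walks -/

/-- A closed trail enters each vertex as often as it leaves it: the lists of tails and of heads both
become the support once the base vertex is added. Having no repeated edge lets list counts be read
as cardinalities. -/
theorem ncard_darts_fst_eq_snd {u : V} {C : G.Walk u u} (hC : C.IsTrail) (w : V) :
    {d : G.Dart | d ∈ C.darts ∧ d.fst = w}.ncard =
      {d : G.Dart | d.symm ∈ C.darts ∧ d.fst = w}.ncard := by
  classical
  have hnodup : C.darts.Nodup := List.Nodup.of_map _ hC.edges_nodup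
  have key : ∀ (P : G.Dart → Prop) [DecidablePred P],
      {d : G.Dart | d ∈ C.darts ∧ P d}.ncard = C.darts.countP (fun d => P d) := by
    intro P _
    rw [List.countP_eq_length_filter, ← List.toFinset_card_of_nodup (hnodup.filter _),
      ← Set.ncard_coe_finset]
    congr 1
    ext d
    simp
  have h2 : {d : G.Dart | d.symm ∈ C.darts ∧ d.fst = w}.ncard =
      {d : G.Dart | d ∈ C.darts ∧ d.snd = w}.ncard := by
    rw [← Set.ncard_image_of_injective _ SimpleGraph.Dart.symm_involutive.injective]
    congr 1
    ext d
    simp only [Set.mem_image, Set.mem_ofPred_eq]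
    constructor
    · rintro ⟨e, ⟨he, rfl⟩, rfl⟩
      exact ⟨he, rfl⟩
    · rintro ⟨hd, rfl⟩
      exact ⟨d.symm, ⟨by rwa [SimpleGraph.Dart.symm_symm], rfl⟩, d.symm_symm⟩
  rw [h2, key, key]
  have h3 := congrArg (List.count w) C.cons_map_snd_darts
  have h4 := congrArg (List.count w) C.map_fst_darts_append
  rw [← h3, List.count_append, List.count_cons, List.count_cons, List.count_nil, zero_add] at h4
  rw [List.count_eq_countP, List.count_eq_countP, List.countP_map, List.countP_map] at h4
  have h5 := Nat.add_right_cancel h4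
  convert h5 using 2 <;> (funext d; simp [Bool.beq_eq_decide_eq])

/-! ### Strong labelings and orientations -/

theorem IsQuadrangulation.next_pow_four (hR : R.IsQuadrangulation) (d : G.Dart) :
    R.next (R.next (R.next (R.next d))) = d := (hR.2 d).1

theorem IsQuadrangulation.eq_of_face_eq (hR : R.IsQuadrangulation) {d e : G.Dart}
    (h : R.face d = R.face e) : e = d ∨ e = R.next d ∨ e = R.next (R.next d) ∨
      e = R.next (R.next (R.next d)) := by
  have hpow : ∀ i : ℕ, (R.next ^ i) d = d ∨ (R.next ^ i) d = R.next d ∨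
      (R.next ^ i) d = R.next (R.next d) ∨ (R.next ^ i) d = R.next (R.next (R.next d)) := by
    intro i
    induction i with
    | zero => left; rfl
    | succ i ih =>
      rw [pow_succ', Equiv.Perm.mul_apply]
      rcases ih with h | h | h | h <;> rw [h]
      · tauto
      · tauto
      · tauto
      · left; exact hR.next_pow_four d
  have h4 : (R.next ^ 4) d = d := (hR.2 d).1
  obtain ⟨i, rfl⟩ := R.face_eq_iff.1 h
  have hi : (R.next ^ i) d = (R.next ^ (i % 4).toNat) d := by
    have h1 : i = (i % 4) + 4 * (i / 4) := (Int.emod_add_mul_ediv i 4).symm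
    have h2 : (i % 4) = ((i % 4).toNat : ℤ) := (Int.toNat_of_nonneg (by omega)).symm
    conv_lhs => rw [h1, zpow_add, Equiv.Perm.mul_apply, zpow_mul]
    have h5 : ((R.next ^ (4 : ℤ)) ^ (i / 4)) d = d := by
      apply Equiv.Perm.zpow_apply_eq_self_of_apply_eq_self
      exact h4
    rw [h5]
    conv_lhs => rw [h2, zpow_natCast]
  rw [hi]
  exact hpow _

/-- A proper colouring of the vertices by `0` and `1`. -/
def IsColouring (G : SimpleGraph V) (β : V → Fin 2) : Prop :=
  ∀ d : G.Dart, β d.snd = β d.fst + 1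

theorem coincide_iff {ℓ : G.Dart → Fin 2} {d : G.Dart} :
    R.Coincide ℓ d ↔ ℓ d = ℓ (R.next d.symm) := by
  rw [Coincide, cw_symm_apply]

theorem coincide_symm_iff {ℓ : G.Dart → Fin 2} {d : G.Dart} :
    R.Coincide ℓ d.symm ↔ ℓ d.symm = ℓ (R.next d) := by
  rw [coincide_iff, SimpleGraph.Dart.symm_symm]

/-- Labelings that agree along an edge, on either of its sides, exactly if the edge leads from
colour `0` to colour `1` with that side on its right, and whose induced orientation has outdegree
`0` at the special vertices and `2` elsewhere. -/
structure IsAdmissible (R : RotationSystem G) (β : V → Fin 2) (s : Fin 2 → V)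
    (ℓ : G.Dart → Fin 2) : Prop where
  next_rule : ∀ d, ℓ (R.next d) = ℓ d + β d.fst
  outdeg_special : ∀ i, R.outdeg ℓ (s i) = 0
  outdeg_inner : ∀ v, (∀ i, v ≠ s i) → R.outdeg ℓ v = 2
  root : ∃ d : G.Dart, d.fst = s 0 ∧ ℓ d = 0

/-- The local equation, applied on both sides of an edge, uses the colours of its two ends, which
differ by `1`; this difference is the edge rule. -/
theorem coincide_symm_iff_not {β : V → Fin 2} (hβ : IsColouring G β) {ℓ : G.Dart → Fin 2}
    (h : ∀ d, ℓ (R.next d) = ℓ d + β d.fst) (d : G.Dart) :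
    R.Coincide ℓ d.symm ↔ ¬ R.Coincide ℓ d := by
  rw [coincide_symm_iff, coincide_iff, h, h]
  change ℓ d.symm = ℓ d + β d.fst ↔ ¬ ℓ d = ℓ d.symm + β d.snd
  rw [hβ]
  generalize ℓ d.symm = x, ℓ d = y, β d.fst = z
  revert x y z
  decide

theorem directed_iff_not_coincide {β : V → Fin 2} (hβ : IsColouring G β) {ℓ : G.Dart → Fin 2}
    (h : ∀ d, ℓ (R.next d) = ℓ d + β d.fst) (d : G.Dart) :
    R.Directed ℓ d ↔ ¬ R.Coincide ℓ d := by
  rw [Directed, coincide_symm_iff_not hβ h, and_self]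

theorem IsStrongLabeling.next_next (hR : R.IsQuadrangulation) {outer : R.Face} {s : Fin 2 → V}
    {ℓ : G.Dart → Fin 2} (h : R.IsStrongLabeling outer s ℓ) (d : G.Dart) :
    ℓ (R.next (R.next d)) = ℓ d + 1 := by
  obtain ⟨e, he, h0, h1, h2, h3⟩ := h.face_rule (R.face d)
  change ℓ (R.next (R.next e)) = 1 at h2
  change ℓ (R.next (R.next (R.next e))) = 1 at h3
  have h4 := hR.next_pow_four e
  rcases hR.eq_of_face_eq he with rfl | rfl | rfl | rfl
  · rw [h0, h2]; rfl
  · rw [h1, h3]; rfl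
  · rw [h4, h0, h2]; rfl
  · rw [h4, h1, h3]; rfl

/-- The defect `H` of the local equation is preserved by reversal (edge rule) and by `R.next` (face
rule), so it is constant. The outer rule evaluates it to `0`. -/
theorem IsStrongLabeling.isAdmissible [Finite V] (hR : R.IsQuadrangulation) {β : V → Fin 2}
    (hβ : IsColouring G β) {outer : R.Face} {s : Fin 2 → V} (hs0 : β (s 0) = 1)
    (houter : R.OnFace (s 0) outer)
    {ℓ : G.Dart → Fin 2} (h : R.IsStrongLabeling outer s ℓ) : R.IsAdmissible β s ℓ := by
  classical
  have := Fintype.ofFinite V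
  let H : G.Dart → Fin 2 := fun d => ℓ d + ℓ (R.next d) + β d.fst
  have hsymm : ∀ d, H d.symm = H d := by
    intro d
    have hx := h.edge_rule d
    rw [coincide_iff, coincide_symm_iff] at hx
    change ℓ d.symm + ℓ (R.next d.symm) + β d.snd = ℓ d + ℓ (R.next d) + β d.fst
    rw [hβ]
    unfold Xor at hx
    generalize ℓ d.symm = x, ℓ d = y, β d.fst = z, ℓ (R.next d.symm) = x', ℓ (R.next d) = y' at *
    revert x y z x' y'
    decide
  have hnext : ∀ d, H (R.next d) = H d := by
    intro d
    change ℓ (R.next d) + ℓ (R.next (R.next d)) + β (R.next d).fst = ℓ d + ℓ (R.next d) + β d.fst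
    rw [h.next_next hR, next_fst, hβ]
    generalize ℓ d = y, β d.fst = z, ℓ (R.next d) = y'
    revert y z y'
    decide
  have hcw : ∀ d, H (R.cw d) = H d := by
    intro d
    have h1 := R.cw_symm_apply (R.cw d)
    rw [Equiv.symm_apply_apply] at h1
    rw [← hsymm, ← hnext (R.cw d).symm, ← h1]
  obtain ⟨a, ha, haf⟩ := houter
  obtain ⟨h0, h1, -, -⟩ := h.outer_rule a haf ha
  -- This dart enters `s 0` along the outer face from a vertex of colour `0`, and the outer rule
  -- labels both it and `a` by `0`.
  have hb : H (R.next.symm a) = 0 := by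
    have h2 := hβ (R.next.symm a)
    rw [← R.next_fst, Equiv.apply_symm_apply, ha, hs0] at h2
    change ℓ (R.next.symm a) + ℓ (R.next (R.next.symm a)) + β (R.next.symm a).fst = 0
    rw [Equiv.apply_symm_apply, h0, h1]
    generalize β (R.next.symm a).fst = z at *
    revert z
    decide
  refine ⟨fun d => ?_, fun i => ?_, fun v hv => ?_, a, ha, h0⟩
  · have hd : H d = 0 := (eq_of_invariant (R := R) hR.1.1 hsymm hcw _ _).trans hb
    change ℓ d + ℓ (R.next d) + β d.fst = 0 at hd
    generalize ℓ d = y, β d.fst = z, ℓ (R.next d) = y' at *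
    revert y z y'
    decide
  · rw [outdeg, Set.ncard_eq_zero (Set.toFinite _), Set.eq_empty_iff_forall_notMem]
    rintro d ⟨hd, hn⟩
    exact hn ((h.special i d hd).trans (h.special i _ ((R.cw_symm_fst d).trans hd)).symm)
  · obtain ⟨d, rfl, k, hk, hkn, h0, h1⟩ := h.vertex_rule v hv
    exact R.outdeg_eq_two_of_intervals hk hkn h0 h1

theorem IsAdmissible.isStrongLabeling [Finite V] (hR : R.IsQuadrangulation) {β : V → Fin 2}
    (hβ : IsColouring G β) {outer : R.Face} {s : Fin 2 → V} (hs : s 0 ≠ s 1)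
    (hsβ : ∀ i, β (s i) = 1) (houter : ∀ i, R.OnFace (s i) outer)
    {ℓ : G.Dart → Fin 2} (h : R.IsAdmissible β s ℓ) : R.IsStrongLabeling outer s ℓ := by
  classical
  have := Fintype.ofFinite V
  have hnext := h.next_rule
  have hspecial0 : ∀ d : G.Dart, d.fst = s 0 → ℓ d = 0 := by
    intro d hd
    obtain ⟨a, ha, h0⟩ := h.root
    rw [R.label_eq_of_outdeg_eq_zero (h.outdeg_special 0) hd ha, h0]
  refine ⟨?_, ?_, ?_, ?_, ?_⟩
  · intro i
    fin_cases i
    · exact hspecial0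
    · obtain ⟨a, ha, haf⟩ := houter 0
      obtain ⟨b, hb, hbf⟩ := houter 1
      -- Equal colours force `s 1` to be opposite `s 0` on the outer face, and two steps of the
      -- local equation change the label.
      have hb1 : ℓ b = 1 := by
        have hβa := hsβ 0
        have hβb := hsβ 1
        rcases hR.eq_of_face_eq (haf.trans hbf.symm) with rfl | rfl | rfl | rfl
        · exact absurd (ha.symm.trans hb) hs
        · rw [next_fst] at hb
          rw [← hb, hβ, ha, hβa] at hβb
          exact absurd hβb (by decide)
        · rw [hnext, hnext, next_fst, hβ, hspecial0 a ha, ha, hβa]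
          rfl
        · rw [next_fst] at hb
          rw [← hb, hβ, next_fst, hβ, next_fst, hβ, ha, hβa] at hβb
          exact absurd hβb (by decide)
      intro d hd
      exact (R.label_eq_of_outdeg_eq_zero (h.outdeg_special 1) hd hb).trans hb1
  · intro v hv
    exact R.exists_intervals_of_outdeg_eq_two (h.outdeg_inner v hv)
  · intro d
    have := coincide_symm_iff_not hβ hnext d
    unfold Xor
    tauto
  · intro f
    obtain ⟨d, rfl⟩ := R.face_surjective f
    -- From a vertex of colour `0` the labels around the face read `x, x, x+1, x+1`; if `x = 1`,
    -- start two steps later.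
    have key : ∀ d, β d.fst = 0 → ∃ e, R.face e = R.face d ∧
        ℓ e = 0 ∧ ℓ (R.next e) = 0 ∧ ℓ ((R.next ^ 2) e) = 1 ∧ ℓ ((R.next ^ 3) e) = 1 := by
      intro d hd
      have h1 : ℓ (R.next d) = ℓ d := by rw [hnext, hd, add_zero]
      have h2 : ℓ (R.next (R.next d)) = ℓ d + 1 := by
        rw [hnext, h1, next_fst, hβ, hd]; rfl
      have h3 : ℓ (R.next (R.next (R.next d))) = ℓ d + 1 := by
        rw [hnext, h2, next_fst, hβ, next_fst, hβ, hd]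
        generalize ℓ d = x
        revert x; decide
      have h4 := hR.next_pow_four d
      have hx : ∀ x : Fin 2, x = 0 ∨ x = 1 := by decide
      rcases hx (ℓ d) with h0 | h0
      · rw [h0] at h1 h2 h3
        exact ⟨d, rfl, h0, h1, h2, h3⟩
      · rw [h0] at h1 h2 h3
        refine ⟨R.next (R.next d), by simp, h2, h3, ?_, ?_⟩
        · change ℓ (R.next (R.next (R.next (R.next d)))) = 1
          rw [h4, h0]
        · change ℓ (R.next (R.next (R.next (R.next (R.next d))))) = 1
          rw [h4, h1]
    have hx : ∀ x : Fin 2, x = 0 ∨ x = 1 := by decide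
    rcases hx (β d.fst) with h0 | h0
    · exact key d h0
    · have h1 : β (R.next d).fst = 0 := by rw [next_fst, hβ, h0]; rfl
      have := key _ h1
      rwa [face_next] at this
  · intro d hd hds
    have h0 := hspecial0 d hds
    have hβd : β d.fst = 1 := by rw [hds, hsβ]
    have hs1 : ∀ e, ℓ (R.next.symm e) = ℓ e + β e.fst + 1 := by
      intro e
      have h1 := hnext (R.next.symm e)
      have h2 := hβ (R.next.symm e)
      rw [← R.next_fst] at h2
      rw [Equiv.apply_symm_apply] at h1 h2
      rw [h1, h2]
      generalize ℓ (R.next.symm e) = x, β (R.next.symm e).fst = y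
      revert x y; decide
    have hs2 : ∀ e, β (R.next.symm e).fst = β e.fst + 1 := by
      intro e
      have h2 := hβ (R.next.symm e)
      rw [← R.next_fst] at h2
      rw [Equiv.apply_symm_apply] at h2
      rw [h2]
      generalize β (R.next.symm e).fst = y
      revert y; decide
    refine ⟨h0, ?_, ?_, ?_⟩
    · rw [hs1, h0, hβd]; rfl
    · change ℓ (R.next.symm (R.next.symm d)) = 1
      rw [hs1, hs1, hs2, h0, hβd]; rfl
    · change ℓ (R.next.symm (R.next.symm (R.next.symm d))) = 1
      rw [hs1, hs1, hs1, hs2, hs2, hs2, h0, hβd]; rfl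

/-- A labeling is determined by its orientation. -/
theorem IsAdmissible.eq_of_directed_iff (hR : G.Connected) [Finite V] {β : V → Fin 2}
    (hβ : IsColouring G β) {s : Fin 2 → V}
    {ℓ m : G.Dart → Fin 2} (hl : R.IsAdmissible β s ℓ) (hm : R.IsAdmissible β s m)
    (h : ∀ d, R.Directed ℓ d ↔ R.Directed m d) : ℓ = m := by
  classical
  have := Fintype.ofFinite V
  have hco : ∀ d, R.Coincide ℓ d ↔ R.Coincide m d := by
    intro d
    have := h d
    rwa [directed_iff_not_coincide hβ hl.next_rule, directed_iff_not_coincide hβ hm.next_rule,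
      not_iff_not] at this
  -- The difference of the labelings is invariant under rotation and reversal, hence constant, and
  -- it vanishes at `s 0`.
  have hcw : ∀ d, ℓ (R.cw d) + m (R.cw d) = ℓ d + m d := by
    intro d
    have := hco (R.cw d)
    rw [Coincide, Coincide, Equiv.symm_apply_apply] at this
    generalize ℓ (R.cw d) = x, m (R.cw d) = y, ℓ d = z, m d = w at *
    revert x y z w; decide
  have hsymm : ∀ d : G.Dart, ℓ d.symm + m d.symm = ℓ d + m d := by
    intro d
    have h1 := hcw (R.next d.symm)
    rw [← R.cw_symm_apply, Equiv.apply_symm_apply, R.cw_symm_apply, hl.next_rule,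
      hm.next_rule] at h1
    generalize ℓ d = x, m d = y, ℓ d.symm = z, m d.symm = w, β d.symm.fst = u at *
    revert x y z w u; decide
  obtain ⟨a, ha, ha0⟩ := hl.root
  obtain ⟨b, hb, hb0⟩ := hm.root
  have hma : m a = 0 := by
    rw [R.label_eq_of_outdeg_eq_zero (hm.outdeg_special 0) ha hb, hb0]
  funext d
  have h1 := eq_of_invariant (R := R) (h := fun d => ℓ d + m d) hR hsymm hcw d a
  simp only [ha0, hma] at h1
  generalize ℓ d = x, m d = y at *
  revert x y; decide

/-! ### Flips -/

theorem complementInside_apply (outer : R.Face) {v : V} (C : G.Walk v v) (ℓ : G.Dart → Fin 2)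
    (d : G.Dart) [Decidable (R.Inside outer C (R.face d))] : R.complementInside outer C ℓ d =
      ℓ d + if R.Inside outer C (R.face d) then 1 else 0 := by
  rw [complementInside]
  split_ifs
  · generalize ℓ d = x
    revert x; decide
  · rw [add_zero]

/-- The two angles at an end of an edge lie in the faces on its two sides, and by the Jordan curve
theorem exactly one of them is complemented if and only if the edge is on `C`. -/
theorem coincide_complementInside_iff [Finite V] (hR : R.IsPlane) (outer : R.Face) {v : V}
    {C : G.Walk v v} (hC : C.IsCycle) (ℓ : G.Dart → Fin 2) (d : G.Dart) :
    R.Coincide (R.complementInside outer C ℓ) d ↔ (R.Coincide ℓ d ↔ d.edge ∉ C.edges) := by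
  classical
  rw [Coincide, Coincide, complementInside_apply, complementInside_apply, face_cw_symm]
  generalize ℓ d = x, ℓ (R.cw.symm d) = y
  by_cases hd : d.edge ∈ C.edges
  · rcases hR.xor_inside_of_mem_edges outer hC hd with ⟨h1, h2⟩ | ⟨h1, h2⟩
    · rw [if_pos h1, if_neg h2]
      simp only [hd]
      revert x y; decide
    · rw [if_pos h1, if_neg h2]
      simp only [hd]
      revert x y; decide
  · rw [inside_iff_of_notMem_edges hd]
    simp [hd]

theorem IsDirectedCycle.mem_darts_iff {β : V → Fin 2} (hβ : IsColouring G β)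
    {ℓ : G.Dart → Fin 2} (h : ∀ d, ℓ (R.next d) = ℓ d + β d.fst) {v : V}
    {C : G.Walk v v} (hC : R.IsDirectedCycle ℓ C) (d : G.Dart) :
    d ∈ C.darts ↔ d.edge ∈ C.edges ∧ ¬ R.Coincide ℓ d := by
  constructor
  · exact fun hd => ⟨List.mem_map_of_mem hd, (hC.2 d hd).1⟩
  · rintro ⟨hd, hn⟩
    obtain ⟨e, he, hed⟩ := List.mem_map.1 hd
    rcases (SimpleGraph.dart_edge_eq_iff _ _).1 hed with rfl | rfl
    · exact he
    · have h1 := (hC.2 _ he).1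
      rw [coincide_symm_iff_not hβ h] at h1
      exact absurd hn h1

/-- Off `C` nothing changes; on `C` the outgoing darts at `w` are traded for the reversals of the
incoming ones, equally many. -/
theorem outdeg_complementInside [Finite V] (hR : R.IsPlane) (outer : R.Face)
    {β : V → Fin 2} (hβ : IsColouring G β)
    {ℓ : G.Dart → Fin 2} (h : ∀ d, ℓ (R.next d) = ℓ d + β d.fst) {v : V}
    {C : G.Walk v v} (hC : R.IsDirectedCycle ℓ C) (w : V) :
    R.outdeg (R.complementInside outer C ℓ) w = R.outdeg ℓ w := by
  classical
  have := Fintype.ofFinite V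
  set A : Set G.Dart := {d | d.fst = w ∧ ¬ R.Coincide ℓ d ∧ d.edge ∉ C.edges}
  have h1 : {d : G.Dart | d.fst = w ∧ ¬ R.Coincide ℓ d} = A ∪ {d | d ∈ C.darts ∧ d.fst = w} := by
    ext d
    simp only [A, Set.mem_union, Set.mem_ofPred_eq, hC.mem_darts_iff hβ h]
    tauto
  have h2 : {d : G.Dart | d.fst = w ∧ ¬ R.Coincide (R.complementInside outer C ℓ) d} =
      A ∪ {d | d.symm ∈ C.darts ∧ d.fst = w} := by
    ext d
    simp only [A, Set.mem_union, Set.mem_ofPred_eq, hC.mem_darts_iff hβ h,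
      coincide_complementInside_iff hR outer hC.1, coincide_symm_iff_not hβ h,
      SimpleGraph.Dart.edge_symm]
    tauto
  rw [outdeg, outdeg, h1, h2, Set.ncard_union_eq, Set.ncard_union_eq,
    ncard_darts_fst_eq_snd hC.1.isTrail]
  · rw [Set.disjoint_left]
    rintro d ⟨-, -, hd⟩ ⟨hd', -⟩
    exact hd (List.mem_map_of_mem hd')
  · rw [Set.disjoint_left]
    rintro d ⟨-, -, hd⟩ ⟨hd', -⟩
    rw [← SimpleGraph.Dart.edge_symm] at hd
    exact hd (List.mem_map_of_mem hd')

theorem IsAdmissible.complementInside [Finite V] (hR : R.IsPlane) {outer : R.Face}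
    {β : V → Fin 2} (hβ : IsColouring G β) {s : Fin 2 → V} (houter : R.OnFace (s 0) outer)
    {ℓ : G.Dart → Fin 2} (h : R.IsAdmissible β s ℓ) {v : V}
    {C : G.Walk v v} (hC : R.IsDirectedCycle ℓ C) :
    R.IsAdmissible β s (R.complementInside outer C ℓ) := by
  classical
  have := Fintype.ofFinite V
  refine ⟨fun d => ?_, fun i => ?_, fun w hw => ?_, ?_⟩
  · rw [complementInside_apply, complementInside_apply, face_next, h.next_rule]
    exact add_right_comm _ _ _
  · rw [outdeg_complementInside hR outer hβ h.next_rule hC, h.outdeg_special]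
  · rw [outdeg_complementInside hR outer hβ h.next_rule hC, h.outdeg_inner w hw]
  · obtain ⟨a, ha, rfl⟩ := houter
    obtain ⟨b, hb, hb0⟩ := h.root
    refine ⟨a, ha, ?_⟩
    rw [complementInside_apply, if_neg (not_inside_outer _ _), add_zero,
      R.label_eq_of_outdeg_eq_zero (h.outdeg_special 0) ha hb, hb0]

theorem directed_complementInside_iff [Finite V] (hR : R.IsPlane) (outer : R.Face)
    {β : V → Fin 2} (hβ : IsColouring G β)
    {ℓ : G.Dart → Fin 2} (h : ∀ d, ℓ (R.next d) = ℓ d + β d.fst) {v : V}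
    {C : G.Walk v v} (hC : C.IsCycle) (d : G.Dart) :
    R.Directed (R.complementInside outer C ℓ) d ↔
      (d.edge ∈ C.edges ∧ R.Directed ℓ d.symm) ∨ (d.edge ∉ C.edges ∧ R.Directed ℓ d) := by
  rw [directed_iff_not_coincide hβ h, directed_iff_not_coincide hβ h, Directed,
    coincide_complementInside_iff hR outer hC, coincide_complementInside_iff hR outer hC,
    coincide_symm_iff_not hβ h, SimpleGraph.Dart.edge_symm]
  tauto

/-! ### Connectivity of the flip graph -/

/-- Extend a path backwards through predecessors in `D`. If it never closed up, there would be a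
path of length `|V|`. Asymmetry prevents the closing dart from merely retracing an edge of the path.
-/
theorem exists_isCycle_of_darts [Finite V] {D : Set G.Dart} (hasymm : ∀ d ∈ D, d.symm ∉ D)
    (hpred : ∀ d ∈ D, ∃ e ∈ D, e.snd = d.fst) (hne : D.Nonempty) :
    ∃ (v : V) (C : G.Walk v v), C.IsCycle ∧ ∀ d ∈ C.darts, d ∈ D := by
  classical
  have := Fintype.ofFinite V
  by_contra hno
  have key : ∀ n : ℕ, ∃ (u v : V) (p : G.Walk u v), p.IsPath ∧ p.length = n ∧
      (∀ d ∈ p.darts, d ∈ D) ∧ ∃ d ∈ D, d.fst = u := by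
    intro n
    induction n with
    | zero =>
      obtain ⟨d, hd⟩ := hne
      exact ⟨d.fst, d.fst, SimpleGraph.Walk.nil, SimpleGraph.Walk.IsPath.nil, rfl,
        by simp, d, hd, rfl⟩
    | succ n ih =>
      obtain ⟨u, v, p, hp, hn, hpD, d, hd, hdu⟩ := ih
      obtain ⟨e, he, hed⟩ := hpred d hd
      obtain ⟨⟨x, y⟩, hxy⟩ := e
      obtain rfl : y = u := hed.trans hdu
      by_cases hx : x ∈ p.support
      · exfalso
        set q := p.takeUntil x hx with hq
        have hqp : q.IsPath := hp.takeUntil hx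
        have hqD : ∀ d ∈ q.darts, d ∈ D :=
          fun d hd => hpD d (p.darts_takeUntil_subset_darts hx hd)
        refine hno ⟨x, SimpleGraph.Walk.cons hxy q, ?_, ?_⟩
        · rw [SimpleGraph.Walk.cons_isCycle_iff]
          refine ⟨hqp, fun hmem => ?_⟩
          obtain ⟨f, hf, hfe⟩ := List.mem_map.1 hmem
          have hfe' : f.edge = (⟨(x, y), hxy⟩ : G.Dart).edge := hfe
          rcases (SimpleGraph.dart_edge_eq_iff _ _).1 hfe' with rfl | rfl
          · have hnd := hqp.support_nodup
            rw [← q.cons_map_snd_darts, List.nodup_cons] at hnd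
            exact hnd.1 (List.mem_map.2 ⟨_, hf, rfl⟩)
          · exact hasymm _ he (hqD _ hf)
        · intro d hd
          rw [SimpleGraph.Walk.darts_cons, List.mem_cons] at hd
          rcases hd with rfl | hd
          · exact he
          · exact hqD d hd
      · refine ⟨x, v, SimpleGraph.Walk.cons hxy p, ?_, ?_, ?_, _, he, rfl⟩
        · exact hp.cons hx
        · rw [SimpleGraph.Walk.length_cons, hn]
        · intro d hd
          rw [SimpleGraph.Walk.darts_cons, List.mem_cons] at hd
          rcases hd with rfl | hd
          · exact he
          · exact hpD d hd
  obtain ⟨u, v, p, hp, hn, -⟩ := key (Fintype.card V)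
  exact absurd hp.length_lt (by omega)

/-- The darts that are directed by `ℓ`, while their reversals are directed by `m`. -/
def diffDarts (R : RotationSystem G) (ℓ m : G.Dart → Fin 2) : Set G.Dart :=
  {d | ¬ R.Coincide ℓ d ∧ R.Coincide m d}

theorem IsAdmissible.outdeg_eq {β : V → Fin 2} {s : Fin 2 → V} {ℓ m : G.Dart → Fin 2}
    (hl : R.IsAdmissible β s ℓ) (hm : R.IsAdmissible β s m) (v : V) :
    R.outdeg ℓ v = R.outdeg m v := by
  by_cases h : ∃ i, v = s i
  · obtain ⟨i, rfl⟩ := h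
    rw [hl.outdeg_special, hm.outdeg_special]
  · rw [not_exists] at h
    rw [hl.outdeg_inner v h, hm.outdeg_inner v h]

/-- If no differing edge entered the tail of `d`, every edge leaving that vertex under `m` would
leave it under `ℓ`. Equal outdegrees would make the two sets equal, yet `d` is only in the second.
-/
theorem IsAdmissible.exists_directedCycle [Finite V] {β : V → Fin 2} (hβ : IsColouring G β)
    {s : Fin 2 → V} {ℓ m : G.Dart → Fin 2}
    (hl : R.IsAdmissible β s ℓ) (hm : R.IsAdmissible β s m) (hne : (R.diffDarts ℓ m).Nonempty) :
    ∃ (v : V) (C : G.Walk v v), C.IsCycle ∧ ∀ d ∈ C.darts, d ∈ R.diffDarts ℓ m := by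
  classical
  have := Fintype.ofFinite V
  have hls := coincide_symm_iff_not hβ hl.next_rule
  have hms := coincide_symm_iff_not hβ hm.next_rule
  refine exists_isCycle_of_darts ?_ ?_ hne
  · rintro d ⟨hd, -⟩ ⟨hd', -⟩
    rw [hls] at hd'
    exact hd' hd
  · rintro d ⟨hd, hd'⟩
    by_contra hno
    have hsub : {e : G.Dart | e.fst = d.fst ∧ ¬ R.Coincide m e} ⊆
        {e : G.Dart | e.fst = d.fst ∧ ¬ R.Coincide ℓ e} := by
      rintro e ⟨he, hem⟩
      refine ⟨he, fun hel => hno ⟨e.symm, ⟨?_, ?_⟩, he⟩⟩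
      · rw [hls, not_not]; exact hel
      · rw [hms]; exact hem
    have heq := Set.eq_of_subset_of_ncard_le hsub (hl.outdeg_eq hm d.fst).le (Set.toFinite _)
    have hmem : d ∈ {e : G.Dart | e.fst = d.fst ∧ ¬ R.Coincide m e} := heq ▸ ⟨rfl, hd⟩
    exact hmem.2 hd'

theorem IsAdmissible.eq_of_diffDarts_eq_empty [Finite V] (hG : G.Connected) {β : V → Fin 2}
    (hβ : IsColouring G β)
    {s : Fin 2 → V} {ℓ m : G.Dart → Fin 2}
    (hl : R.IsAdmissible β s ℓ) (hm : R.IsAdmissible β s m) (h : R.diffDarts ℓ m = ∅) : ℓ = m := by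
  have hls := coincide_symm_iff_not hβ hl.next_rule
  have hms := coincide_symm_iff_not hβ hm.next_rule
  have hd : ∀ d, ¬ R.Coincide ℓ d → ¬ R.Coincide m d := by
    intro d h1 h2
    exact Set.eq_empty_iff_forall_notMem.1 h d ⟨h1, h2⟩
  refine hl.eq_of_directed_iff hG hβ hm fun d => ?_
  rw [directed_iff_not_coincide hβ hl.next_rule, directed_iff_not_coincide hβ hm.next_rule]
  refine ⟨hd d, fun h1 h2 => ?_⟩
  have := hd d.symm
  rw [hls, hms, not_not, not_not] at this
  exact h1 (this h2)

/-- Flipping makes the edges of `C` agree with `m` and leaves all others alone, which gives the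
decreasing measure for connectivity. -/
theorem diffDarts_complementInside_ssubset [Finite V] (hR : R.IsPlane) (outer : R.Face)
    {β : V → Fin 2} (hβ : IsColouring G β) {s : Fin 2 → V} {ℓ m : G.Dart → Fin 2}
    (hl : R.IsAdmissible β s ℓ) (hm : R.IsAdmissible β s m) {v : V} {C : G.Walk v v}
    (hC : C.IsCycle) (hCD : ∀ d ∈ C.darts, d ∈ R.diffDarts ℓ m) :
    R.diffDarts (R.complementInside outer C ℓ) m ⊂ R.diffDarts ℓ m := by
  have hls := coincide_symm_iff_not hβ hl.next_rule
  have hms := coincide_symm_iff_not hβ hm.next_rule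
  have hdir : R.IsDirectedCycle ℓ C :=
    ⟨hC, fun d hd => (directed_iff_not_coincide hβ hl.next_rule d).2 (hCD d hd).1⟩
  have hco := coincide_complementInside_iff hR outer hC ℓ
  rw [Set.ssubset_iff_of_subset]
  · have hne : C.darts ≠ [] := fun h => hC.not_nil (SimpleGraph.Walk.darts_eq_nil.1 h)
    obtain ⟨d, hd⟩ := List.exists_mem_of_ne_nil _ hne
    refine ⟨d, hCD d hd, fun h => h.1 ?_⟩
    have hdC : d.edge ∈ C.edges := List.mem_map_of_mem hd
    rw [hco]
    exact iff_of_false (hCD d hd).1 (fun h => h hdC)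
  · rintro d ⟨h1, h2⟩
    refine ⟨fun h3 => h1 ?_, h2⟩
    rw [hco]
    refine iff_of_true h3 fun hdC => ?_
    have hmem : d.symm ∈ C.darts := by
      rw [hdir.mem_darts_iff hβ hl.next_rule, SimpleGraph.Dart.edge_symm, hls, not_not]
      exact ⟨hdC, h3⟩
    have := (hCD _ hmem).2
    rw [hms] at this
    exact this h2

theorem flipGraph_preconnected [Finite V] (hR : R.IsQuadrangulation) {β : V → Fin 2}
    (hβ : IsColouring G β) {outer : R.Face} {s : Fin 2 → V} (hs : s 0 ≠ s 1)
    (hsβ : ∀ i, β (s i) = 1) (houter : ∀ i, R.OnFace (s i) outer) :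
    (R.flipGraph outer s).Preconnected := by
  classical
  have := Fintype.ofFinite V
  have key : ∀ (n : ℕ) (L M : {ℓ : G.Dart → Fin 2 // R.IsStrongLabeling outer s ℓ}),
      (R.diffDarts L.1 M.1).ncard = n → (R.flipGraph outer s).Reachable L M := by
    intro n
    induction n using Nat.strong_induction_on with
    | _ n ih =>
      intro L M hn
      have hl := L.2.isAdmissible hR hβ (hsβ 0) (houter 0)
      have hm := M.2.isAdmissible hR hβ (hsβ 0) (houter 0)
      rcases (R.diffDarts L.1 M.1).eq_empty_or_nonempty with hemp | hne
      · rw [Subtype.ext (hl.eq_of_diffDarts_eq_empty hR.1.1 hβ hm hemp)]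
      · obtain ⟨v, C, hC, hCD⟩ := hl.exists_directedCycle hβ hm hne
        have hdir : R.IsDirectedCycle L.1 C :=
          ⟨hC, fun d hd => (directed_iff_not_coincide hβ hl.next_rule d).2 (hCD d hd).1⟩
        have hflip := hl.complementInside hR.1 hβ (houter 0) hdir
        let N : {ℓ : G.Dart → Fin 2 // R.IsStrongLabeling outer s ℓ} :=
          ⟨_, hflip.isStrongLabeling hR hβ hs hsβ houter⟩
        have hss := diffDarts_complementInside_ssubset hR.1 outer hβ hl hm hC hCD
        have hadj : (R.flipGraph outer s).Adj L N := by
          rw [flipGraph, SimpleGraph.fromRel_adj]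
          refine ⟨fun h => ?_, Or.inl ⟨v, C, hdir, rfl⟩⟩
          have h' : R.complementInside outer C L.1 = L.1 := (congrArg Subtype.val h).symm
          rw [h'] at hss
          exact hss.ne rfl
        exact hadj.reachable.trans
          (ih _ (hn ▸ Set.ncard_lt_ncard hss (Set.toFinite _)) N M rfl)
  exact fun L M => key _ L M rfl

/-! ### Counting edges -/

theorem ncard_darts_edge_mem [Finite V] (S : Set (Sym2 V)) :
    {d : G.Dart | d.edge ∈ S}.ncard = 2 * {e : G.edgeSet | e.1 ∈ S}.ncard := by
  classical
  have := Fintype.ofFinite V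
  rw [Set.ncard_eq_toFinset_card', Set.ncard_eq_toFinset_card',
    Finset.card_eq_sum_card_fiberwise (f := fun d : G.Dart => (⟨d.edge, d.edge_mem⟩ : G.edgeSet))
      (t := {e : G.edgeSet | e.1 ∈ S}.toFinset)]
  · rw [Finset.sum_congr rfl (g := fun _ => 2), Finset.sum_const, smul_eq_mul, mul_comm]
    intro e he
    rw [← G.dart_edge_fiber_card e.1 e.2]
    congr 1
    ext d
    have he' : e.1 ∈ S := by simpa using he
    simp only [Finset.mem_filter, Set.mem_toFinset, Set.mem_ofPred_eq, Finset.mem_univ, true_and,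
      Subtype.ext_iff]
    refine ⟨fun h => h.2, fun h => ⟨h ▸ he', h⟩⟩
  · intro d hd
    simpa using hd

theorem IsQuadrangulation.next_pow_ne (hR : R.IsQuadrangulation) (d : G.Dart) :
    R.next d ≠ d ∧ R.next (R.next d) ≠ d ∧ R.next (R.next (R.next d)) ≠ d := by
  have hinj := (hR.2 d).2
  refine ⟨fun h => ?_, fun h => ?_, fun h => ?_⟩
  · have : (0 : Fin 4) = 1 := hinj (congrArg (fun d : G.Dart => d.fst) h.symm)
    exact absurd this (by decide)
  · have : (0 : Fin 4) = 2 := hinj (congrArg (fun d : G.Dart => d.fst) h.symm)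
    exact absurd this (by decide)
  · have : (0 : Fin 4) = 3 := hinj (congrArg (fun d : G.Dart => d.fst) h.symm)
    exact absurd this (by decide)

theorem IsQuadrangulation.ncard_face (hR : R.IsQuadrangulation) (f : R.Face) :
    {d : G.Dart | R.face d = f}.ncard = 4 := by
  obtain ⟨a, rfl⟩ := R.face_surjective f
  have hset : {d : G.Dart | R.face d = R.face a} =
      Set.range fun i : Fin 4 => (R.next ^ (i : ℕ)) a := by
    ext d
    simp only [Set.mem_ofPred_eq, Set.mem_range]
    constructor
    · intro h
      rcases hR.eq_of_face_eq h.symm with rfl | rfl | rfl | rfl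
      · exact ⟨0, rfl⟩
      · exact ⟨1, rfl⟩
      · exact ⟨2, rfl⟩
      · exact ⟨3, rfl⟩
    · rintro ⟨i, rfl⟩
      exact (R.face_eq_iff.2 ⟨(i : ℕ), by rw [zpow_natCast]⟩).symm
  have hinj : Function.Injective fun i : Fin 4 => (R.next ^ (i : ℕ)) a := fun i j h =>
    (hR.2 a).2 (congrArg (fun d : G.Dart => d.fst) h)
  rw [hset, ← Set.image_univ, Set.ncard_image_of_injective _ hinj, Set.ncard_univ, Nat.card_fin]

/-- Count darts twice, by edges and by faces of length four, and substitute into Euler's formula. -/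
theorem IsQuadrangulation.card_edgeSet [Finite V] (hR : R.IsQuadrangulation) :
    Nat.card G.edgeSet + 4 = 2 * Nat.card V := by
  classical
  have := Fintype.ofFinite V
  have := Fintype.ofFinite R.Face
  have h1 := ncard_darts_edge_mem (G := G) Set.univ
  have h2 : (Set.univ : Set G.Dart).ncard = 4 * Nat.card R.Face := by
    rw [Set.ncard_eq_toFinset_card', Finset.card_eq_sum_card_fiberwise (f := R.face)
      (t := Finset.univ) (fun _ _ => Finset.mem_coe.2 (Finset.mem_univ _)),
      Finset.sum_congr rfl (g := fun _ => 4),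
      Finset.sum_const, smul_eq_mul, mul_comm, Finset.card_univ, Nat.card_eq_fintype_card]
    intro f _
    rw [← hR.ncard_face f, Set.ncard_eq_toFinset_card']
    congr 1
    ext d
    simp
  have h3 : {d : G.Dart | d.edge ∈ (Set.univ : Set (Sym2 V))} = Set.univ := by ext; simp
  have h4 : {e : G.edgeSet | e.1 ∈ (Set.univ : Set (Sym2 V))} = Set.univ := by ext; simp
  rw [h3, h4, h2, Set.ncard_univ] at h1
  have := hR.1.2
  omega

theorem IsEvenDartSet.exists_ne [Finite V] {D : Set G.Dart} (hD : IsEvenDartSet D) {d : G.Dart}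
    (hd : d ∈ D) : ∃ e ∈ D, e.fst = d.fst ∧ e ≠ d := by
  classical
  have := Fintype.ofFinite V
  have h2 : 1 < {e | e ∈ D ∧ e.fst = d.fst}.ncard := by
    have hpos : 0 < {e | e ∈ D ∧ e.fst = d.fst}.ncard :=
      (Set.ncard_pos (Set.toFinite _)).2 ⟨d, hd, rfl⟩
    obtain ⟨m, hm⟩ := hD.even d.fst
    omega
  obtain ⟨e, ⟨he, hed⟩, hne⟩ := Set.exists_ne_of_one_lt_ncard h2 d
  exact ⟨e, he, hed, hne⟩

/-- From an edge in `D`, evenness continues it at both ends; the two new vertices differ because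
their colours do. This gives four vertices with at least two darts each, so `D` has at least four
edges. -/
theorem IsEvenDartSet.eight_le_ncard [Finite V] {β : V → Fin 2} (hβ : IsColouring G β)
    {D : Set G.Dart} (hD : IsEvenDartSet D) (hne : D.Nonempty) : 8 ≤ D.ncard := by
  classical
  have := Fintype.ofFinite V
  have hβ1 : ∀ d : G.Dart, β d.snd ≠ β d.fst := by
    intro d
    rw [hβ]
    generalize β d.fst = x
    revert x; decide
  obtain ⟨d, hd⟩ := hne
  obtain ⟨a, ha, had, hne1⟩ := hD.exists_ne hd
  obtain ⟨b, hb, hbd, hne2⟩ := hD.exists_ne ((hD.symm_mem d).2 hd)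
  change b.fst = d.snd at hbd
  have hne1' : a.snd ≠ d.snd := fun h => hne1 (SimpleGraph.Dart.ext _ _ (Prod.ext had h))
  have hne2' : b.snd ≠ d.fst := fun h => hne2 (SimpleGraph.Dart.ext _ _ (Prod.ext hbd h))
  have h1 := hβ a
  have h2 := hβ b
  rw [had] at h1
  rw [hbd] at h2
  have h3 := hβ1 d
  have hβd : β d.snd + 1 = β d.fst := by
    rw [hβ]
    generalize β d.fst = x
    revert x; decide
  rw [hβd] at h2
  rw [← hβ d] at h1
  let T : Finset V := {d.fst, d.snd, a.snd, b.snd}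
  have hT : T.card = 4 := by
    rw [Finset.card_insert_of_notMem, Finset.card_insert_of_notMem, Finset.card_pair]
    · intro h
      rw [h, h2] at h1
      exact h3 h1.symm
    · simp only [Finset.mem_insert, Finset.mem_singleton, not_or]
      exact ⟨fun h => hne1' h.symm, fun h => h3 (by rw [h, h2])⟩
    · simp only [Finset.mem_insert, Finset.mem_singleton, not_or]
      exact ⟨fun h => h3 (by rw [← h]), fun h => h3 (by rw [← h1, ← h]), fun h => hne2' h.symm⟩
  have hmem : ∀ v ∈ T, ∃ e ∈ D, e.fst = v := by
    intro v hv
    simp only [T, Finset.mem_insert, Finset.mem_singleton] at hv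
    rcases hv with rfl | rfl | rfl | rfl
    · exact ⟨d, hd, rfl⟩
    · exact ⟨d.symm, (hD.symm_mem d).2 hd, rfl⟩
    · exact ⟨a.symm, (hD.symm_mem a).2 ha, rfl⟩
    · exact ⟨b.symm, (hD.symm_mem b).2 hb, rfl⟩
  have hfib : ∀ v ∈ T, 2 ≤ (D.toFinset.filter fun e => e.fst = v).card := by
    intro v hv
    obtain ⟨e, he, rfl⟩ := hmem v hv
    obtain ⟨e', he', hee', hne'⟩ := hD.exists_ne he
    rw [← Finset.card_pair hne']
    apply Finset.card_le_card
    intro x hx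
    simp only [Finset.mem_insert, Finset.mem_singleton] at hx
    rcases hx with rfl | rfl <;> simp [*]
  calc 8 = T.card * 2 := by rw [hT]
    _ ≤ ∑ v ∈ T, (D.toFinset.filter fun e => e.fst = v).card := by
      rw [← smul_eq_mul]; exact Finset.card_nsmul_le_sum _ _ _ hfib
    _ = (D.toFinset.filter fun e => e.fst ∈ T).card := by
      rw [Finset.card_eq_sum_card_fiberwise (f := fun e : G.Dart => e.fst) (t := T)]
      · refine Finset.sum_congr rfl fun v hv => ?_
        congr 1
        ext e
        simp only [Finset.mem_filter]
        constructor
        · rintro ⟨h1, rfl⟩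
          exact ⟨⟨h1, hv⟩, rfl⟩
        · rintro ⟨⟨h1, -⟩, h2⟩
          exact ⟨h1, h2⟩
      · intro e he
        simpa using (Finset.mem_filter.1 he).2
    _ ≤ D.toFinset.card := Finset.card_filter_le _ _
    _ = D.ncard := (Set.ncard_eq_toFinset_card' D).symm

/-- The number of edges induced by a set of vertices, in terms of the number of faces into which
these edges divide the sphere. -/
theorem IsPlane.card_induced_edges_add_two_le [Finite V] (hR : R.IsPlane) [Nonempty R.Face]
    {U : Set V} (hU : U.Nonempty) :
    {e : G.edgeSet | ∀ v ∈ e.1, v ∈ U}.ncard + 2 ≤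
      U.ncard + Nat.card (Quot (R.Across {e | ∀ v ∈ e, v ∈ U})) := by
  classical
  have := Fintype.ofFinite V
  set X : Set (Sym2 V) := {e | ∀ v ∈ e, v ∈ U} with hX
  set S : Set G.edgeSet := {e | ∀ v ∈ e.1, v ∈ U} with hS
  let Q := Quot (R.Across X)
  have hfin : Finite Q := Finite.of_surjective (Quot.mk _) Quot.mk_surjective
  have := Fintype.ofFinite Q
  set B := R.coboundary (Quot.mk (R.Across X)) S with hB
  have hrank := finrank_ker_incidence U S
  have hrankB := B.finrank_range_add_finrank_ker
  rw [Module.finrank_pi] at hrankB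
  have hkerA : 0 < Module.finrank (ZMod 2)
      (LinearMap.ker (incidence U S).transpose.mulVecLin) := by
    rw [Module.finrank_pos_iff_exists_ne_zero]
    refine ⟨⟨fun _ => 1, ?_⟩, ?_⟩
    · rw [LinearMap.mem_ker, Matrix.mulVecLin_apply]
      ext ⟨⟨e, he⟩, heS⟩
      obtain ⟨d, hd⟩ := exists_dart_of_mem_edgeSet ⟨e, he⟩
      dsimp only at hd
      subst hd
      rw [incidence_transpose_mulVec U S (fun e he => he) _ d heS]
      rfl
    · intro h
      obtain ⟨u, hu⟩ := hU
      have := congrFun (congrArg Subtype.val h) ⟨u, hu⟩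
      exact one_ne_zero this
  have hkerB : 0 < Module.finrank (ZMod 2) (LinearMap.ker B) := by
    rw [Module.finrank_pos_iff_exists_ne_zero]
    refine ⟨⟨fun _ => 1, ?_⟩, ?_⟩
    · rw [LinearMap.mem_ker]
      ext ⟨⟨e, he⟩, heS⟩
      obtain ⟨d, hd⟩ := exists_dart_of_mem_edgeSet ⟨e, he⟩
      dsimp only at hd
      subst hd
      rw [hB, coboundary_apply]
      rfl
    · intro h
      obtain ⟨f⟩ := ‹Nonempty R.Face›
      have := congrFun (congrArg Subtype.val h) (Quot.mk _ f)
      exact one_ne_zero this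
  -- An even set of edges inside `U` bounds a set of faces, which is a union of regions because its
  -- boundary uses only these edges. Both kernels bounded below contain the constant `1`, so
  -- comparing dimensions yields the inequality.
  have hle : LinearMap.ker (incidence U S).mulVecLin ≤ LinearMap.range B := by
    intro z hz
    let D : Set G.Dart := {d | ∃ h : (⟨d.edge, d.edge_mem⟩ : G.edgeSet) ∈ S,
      z ⟨⟨d.edge, d.edge_mem⟩, h⟩ = 1}
    have hsymm : ∀ d, d.symm ∈ D ↔ d ∈ D := by
      intro d
      simp only [D, Set.mem_ofPred_eq, SimpleGraph.Dart.edge_symm]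
    have hD : IsEvenDartSet D := by
      refine ⟨hsymm, fun v => ?_⟩
      by_cases hv : v ∈ U
      · have h1 : (incidence U S).mulVec z ⟨v, hv⟩ = 0 := by
          rw [← Matrix.mulVecLin_apply, LinearMap.mem_ker.1 hz]; rfl
        rw [incidence_mulVec, ZMod.natCast_eq_zero_iff_even] at h1
        convert h1 using 1
        rw [← ncard_filter_edges_at hsymm,
          ← Set.ncard_image_of_injective _ (Subtype.val_injective (p := fun e => e ∈ S))]
        congr 1
        ext ⟨e, he⟩
        obtain ⟨d, hd⟩ := exists_dart_of_mem_edgeSet ⟨e, he⟩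
        dsimp only at hd
        subst hd
        simp only [Set.mem_image, Set.mem_ofPred_eq]
        rw [exists_edge_eq_iff hsymm]
        constructor
        · rintro ⟨h1, h2, h3⟩
          exact ⟨⟨_, h2⟩, ⟨h1, h3⟩, rfl⟩
        · rintro ⟨⟨e', h2⟩, ⟨h1, h3⟩, rfl⟩
          exact ⟨h1, h2, h3⟩
      · suffices h : {d | d ∈ D ∧ d.fst = v} = ∅ by
          rw [h, Set.ncard_empty]
          exact Even.zero
        rw [Set.eq_empty_iff_forall_notMem]
        rintro d ⟨⟨hd, -⟩, rfl⟩
        exact hv (hd _ (Sym2.mem_mk_left _ _))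
    obtain ⟨F, hF⟩ := hR.exists_boundary_eq hD
    have hlift : ∀ x y, R.Across X x y →
        (if x ∈ F then (1 : ZMod 2) else 0) = if y ∈ F then 1 else 0 := by
      rintro x y ⟨d, hd, rfl, rfl⟩
      have hnb : d ∉ R.boundary F := fun h => by
        rw [hF] at h
        exact hd h.1
      change ¬ Xor _ _ at hnb
      rw [not_xor] at hnb
      simp only [hnb]
    refine ⟨Quot.lift _ hlift, ?_⟩
    ext ⟨⟨e, he⟩, heS⟩
    obtain ⟨d, hd⟩ := exists_dart_of_mem_edgeSet ⟨e, he⟩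
    dsimp only at hd
    subst hd
    rw [hB, coboundary_apply]
    have h1 : d ∈ R.boundary F ↔ z ⟨⟨d.edge, he⟩, heS⟩ = 1 := by
      rw [hF]
      exact ⟨fun h => h.2, fun h => ⟨heS, h⟩⟩
    change Xor _ _ ↔ _ at h1
    change (if R.face d ∈ F then (1 : ZMod 2) else 0) + (if R.face d.symm ∈ F then 1 else 0) = _
    generalize z ⟨⟨d.edge, he⟩, heS⟩ = x at *
    by_cases h2 : R.face d ∈ F <;> by_cases h3 : R.face d.symm ∈ F <;>
      simp only [h2, h3, if_true, if_false, Xor] at h1 ⊢ <;> revert h1 <;> revert x <;> decide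
  have hfr := Submodule.finrank_mono hle
  rw [Nat.card_coe_set_eq, Nat.card_coe_set_eq] at hrank
  rw [Nat.card_eq_fintype_card (α := Quot (R.Across X))]
  change _ = Fintype.card (Quot (R.Across X)) at hrankB
  omega

/-- With at least two regions, each has a nonempty even boundary, hence at least `8` darts. Each
dart of `X` bounds at most two regions and no other dart bounds any, so `8q ≤ 4|X|` for `q` regions.
-/
theorem IsPlane.two_mul_card_quot_le [Finite V] (hR : R.IsPlane)
    {β : V → Fin 2} (hβ : IsColouring G β) {X : Set (Sym2 V)}
    (hX : 2 ≤ Nat.card (Quot (R.Across X))) :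
    2 * Nat.card (Quot (R.Across X)) ≤ {e : G.edgeSet | e.1 ∈ X}.ncard := by
  classical
  have := Fintype.ofFinite V
  have hfin : Finite (Quot (R.Across X)) := Finite.of_surjective (Quot.mk _) Quot.mk_surjective
  have := Fintype.ofFinite (Quot (R.Across X))
  let D : Quot (R.Across X) → Set G.Dart := fun q => R.boundary {x | Quot.mk _ x = q}
  have h8 : ∀ q, 8 ≤ (D q).ncard := by
    intro q
    refine (R.isEvenDartSet_boundary _).eight_le_ncard hβ ?_
    by_contra hemp
    have hconst := face_function_eq (R := R) hR.1 (f := fun x => Quot.mk (R.Across X) x = q)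
      (fun d => by
        by_contra h
        refine hemp ⟨d, ?_⟩
        change Xor (Quot.mk _ (R.face d) = q) (Quot.mk _ (R.face d.symm) = q)
        by_cases h1 : Quot.mk (R.Across X) (R.face d) = q <;>
        by_cases h2 : Quot.mk (R.Across X) (R.face d.symm) = q <;> simp_all [Xor])
    obtain ⟨x, hx⟩ := Quot.mk_surjective q
    have hsub : Subsingleton (Quot (R.Across X)) := by
      refine ⟨fun a b => ?_⟩
      have hall : ∀ a, a = q := by
        intro a
        obtain ⟨y, rfl⟩ := Quot.mk_surjective a
        exact (hconst x y).mp hx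
      rw [hall a, hall b]
    have := Finite.card_le_one_iff_subsingleton.2 hsub
    omega
  have hup : ∀ d : G.Dart, (Finset.univ.filter fun q => d ∈ D q).card ≤
      if d.edge ∈ X then 2 else 0 := by
    intro d
    split_ifs with hd
    · refine (Finset.card_le_card (t := {Quot.mk _ (R.face d), Quot.mk _ (R.face d.symm)})
        ?_).trans Finset.card_le_two
      intro q hq
      rw [Finset.mem_filter] at hq
      rw [Finset.mem_insert, Finset.mem_singleton]
      rcases hq.2 with ⟨h, -⟩ | ⟨h, -⟩
      · exact Or.inl h.symm
      · exact Or.inr h.symm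
    · rw [Nat.le_zero, Finset.card_eq_zero, Finset.filter_eq_empty_iff]
      intro q _ hq
      have : Quot.mk (R.Across X) (R.face d) = Quot.mk _ (R.face d.symm) :=
        Quot.sound ⟨d, hd, rfl, rfl⟩
      change Xor (Quot.mk _ (R.face d) = q) (Quot.mk _ (R.face d.symm) = q) at hq
      rw [this] at hq
      exact (_root_.xor_self _ ▸ hq :)
  have hsum : ∑ q, (D q).ncard ≤ ∑ d : G.Dart, if d.edge ∈ X then 2 else 0 := by
    calc ∑ q, (D q).ncard = ∑ q, (Finset.univ.filter fun d => d ∈ D q).card := by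
          refine Finset.sum_congr rfl fun q _ => ?_
          rw [Set.ncard_eq_toFinset_card']
          congr 1
          ext d
          simp
      _ = ∑ d : G.Dart, (Finset.univ.filter fun q => d ∈ D q).card := by
          simp only [Finset.card_filter]
          exact Finset.sum_comm
      _ ≤ _ := Finset.sum_le_sum fun d _ => hup d
  have hlow : Fintype.card (Quot (R.Across X)) * 8 ≤ ∑ q, (D q).ncard := by
    rw [← smul_eq_mul, ← Finset.card_univ]
    exact Finset.card_nsmul_le_sum _ _ _ fun q _ => h8 q
  rw [← Finset.sum_filter, Finset.sum_const, smul_eq_mul] at hsum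
  have hd := ncard_darts_edge_mem (G := G) X
  rw [Set.ncard_eq_toFinset_card', Set.toFinset_ofPred] at hd
  rw [hd] at hsum
  rw [Nat.card_eq_fintype_card]
  omega

/-- For at least two regions, eliminate their number from the two preceding bounds. Otherwise there
are fewer than `|U|` edges, enough when `|U| ≥ 3`; and `U = {s 0, s 1}` spans no edge, as its
vertices share a colour. -/
theorem IsQuadrangulation.card_induced_edges_add_four_le [Finite V] (hR : R.IsQuadrangulation)
    [Nonempty R.Face] {β : V → Fin 2} (hβ : IsColouring G β) {s : Fin 2 → V} (hs : s 0 ≠ s 1)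
    (hsβ : ∀ i, β (s i) = 1) {U : Set V} (hU : ∀ i, s i ∈ U) :
    {e : G.edgeSet | ∀ v ∈ e.1, v ∈ U}.ncard + 4 ≤ 2 * U.ncard := by
  classical
  have := Fintype.ofFinite V
  have h1 := hR.1.card_induced_edges_add_two_le (U := U) ⟨_, hU 0⟩
  by_cases hQ : 2 ≤ Nat.card (Quot (R.Across {e | ∀ v ∈ e, v ∈ U}))
  · have h2 := hR.1.two_mul_card_quot_le hβ hQ
    change _ ≤ {e : G.edgeSet | ∀ v ∈ e.1, v ∈ U}.ncard at h2
    omega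
  · have hsub : ({s 0, s 1} : Set V) ⊆ U := by
      rintro x (rfl | rfl)
      · exact hU 0
      · exact hU 1
    have h2 : 2 ≤ U.ncard := by
      rw [← Set.ncard_pair hs]
      exact Set.ncard_le_ncard hsub (Set.toFinite _)
    by_cases h3 : 3 ≤ U.ncard
    · omega
    · have hUeq : ({s 0, s 1} : Set V) = U :=
        Set.eq_of_subset_of_ncard_le hsub (by rw [Set.ncard_pair hs]; omega) (Set.toFinite _)
      have hemp : {e : G.edgeSet | ∀ v ∈ e.1, v ∈ U} = ∅ := by
        rw [Set.eq_empty_iff_forall_notMem]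
        rintro ⟨e, he⟩ heU
        obtain ⟨d, hd⟩ := exists_dart_of_mem_edgeSet ⟨e, he⟩
        dsimp only at hd
        subst hd
        have hcol : ∀ v ∈ U, β v = 1 := by
          rw [← hUeq]
          rintro v (rfl | rfl)
          · exact hsβ 0
          · exact hsβ 1
        have ha := hcol _ (heU _ (Sym2.mem_mk_left _ _))
        have hb := hcol _ (heU _ (Sym2.mem_mk_right _ _))
        rw [hβ, ha] at hb
        exact absurd hb (by decide)
      rw [hemp, Set.ncard_empty]
      omega

/-! ### Existence of a strong labeling -/

/-- A plane quadrangulation has an orientation with outdegree `0` at the two special vertices and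
`2` at all the others. -/
theorem IsQuadrangulation.exists_two_orientation [Finite V] (hR : R.IsQuadrangulation)
    [Nonempty R.Face] {β : V → Fin 2} (hβ : IsColouring G β) {s : Fin 2 → V} (hs : s 0 ≠ s 1)
    (hsβ : ∀ i, β (s i) = 1) :
    ∃ O : Set G.Dart, (∀ d, d.symm ∈ O ↔ d ∉ O) ∧ (∀ i, ∀ d : G.Dart, d.fst = s i → d ∉ O) ∧
      ∀ v, (∀ i, v ≠ s i) → {d : G.Dart | d.fst = v ∧ d ∈ O}.ncard = 2 := by
  classical
  have := Fintype.ofFinite V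
  -- Each non-special vertex appears in two copies, each of which is to claim an incident edge as
  -- outgoing.
  let t : {v : V // ∀ i, v ≠ s i} × Fin 2 → Finset G.edgeSet :=
    fun x => Finset.univ.filter fun e => x.1.1 ∈ e.1
  have hE := hR.card_edgeSet
  -- The edges meeting `W` are those not induced by its complement, which contains `s 0` and `s 1`.
  -- Their number is at least `(2|V| - 4) - (2(|V| - |W|) - 4) = 2|W|`.
  have hHall : ∀ A : Finset ({v : V // ∀ i, v ≠ s i} × Fin 2), A.card ≤ (A.biUnion t).card := by
    intro A
    let W : Finset V := A.image fun x => x.1.1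
    have hsW : ∀ i, s i ∈ (↑W : Set V)ᶜ := by
      intro i h
      obtain ⟨x, -, hx⟩ := Finset.mem_image.1 (Finset.mem_coe.1 h)
      exact x.1.2 i hx
    have h1 := hR.card_induced_edges_add_four_le hβ hs hsβ hsW
    have h2 := Set.ncard_add_ncard_compl (↑W : Set V)
    rw [Set.ncard_coe_finset] at h2
    have h3 : {e : G.edgeSet | ∀ v ∈ e.1, v ∈ (↑W : Set V)ᶜ}ᶜ = ↑(A.biUnion t) := by
      ext e
      simp only [Set.mem_compl_iff, Set.mem_ofPred_eq, Finset.mem_coe, Finset.mem_biUnion, t,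
        Finset.mem_filter, Finset.mem_univ, true_and, not_forall, not_not, W, Finset.mem_image]
      constructor
      · rintro ⟨v, hv, x, hx, rfl⟩
        exact ⟨x, hx, hv⟩
      · rintro ⟨x, hx, hv⟩
        exact ⟨_, hv, x, hx, rfl⟩
    have h4 := Set.ncard_add_ncard_compl {e : G.edgeSet | ∀ v ∈ e.1, v ∈ (↑W : Set V)ᶜ}
    rw [h3, Set.ncard_coe_finset] at h4
    have h5 : A.card ≤ W.card * 2 := by
      have := Finset.card_le_card_of_injOn (s := A) (t := W ×ˢ (Finset.univ : Finset (Fin 2)))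
        (fun x => (x.1.1, x.2))
        (fun x hx => Finset.mem_product.2 ⟨Finset.mem_image.2 ⟨x, hx, rfl⟩, Finset.mem_univ _⟩)
        (fun x _ y _ h => Prod.ext (Subtype.ext (Prod.mk.inj h).1) (Prod.mk.inj h).2)
      rwa [Finset.card_product, Finset.card_univ, Fintype.card_fin] at this
    omega
  obtain ⟨φ, hφ, hφt⟩ := (Finset.all_card_le_biUnion_card_iff_exists_injective t).1 hHall
  have hφv : ∀ x, x.1.1 ∈ (φ x).1 := fun x => (Finset.mem_filter.1 (hφt x)).2
  -- Both sides equal `2|V| - 4`, so the matching is a bijection and every edge is claimed by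
  -- exactly one end.
  have hcard : Nat.card G.edgeSet ≤ Nat.card ({v : V // ∀ i, v ≠ s i} × Fin 2) := by
    have h1 : Nat.card {v : V // ∀ i, v ≠ s i} = (({s 0, s 1} : Set V)ᶜ).ncard := by
      rw [← Nat.card_coe_set_eq]
      refine Nat.card_congr (Equiv.subtypeEquivRight fun v => ?_)
      simp [Fin.forall_fin_two]
    have h2 := Set.ncard_add_ncard_compl ({s 0, s 1} : Set V)
    rw [Set.ncard_pair hs] at h2
    rw [Nat.card_prod, Nat.card_fin, h1]
    omega
  have hbij := hφ.bijective_of_nat_card_le hcard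
  refine ⟨{d | ∃ x, x.1.1 = d.fst ∧ (φ x).1 = d.edge}, ?_, ?_, ?_⟩
  · intro d
    simp only [Set.mem_ofPred_eq, SimpleGraph.Dart.edge_symm]
    obtain ⟨x, hx⟩ := hbij.2 ⟨d.edge, d.edge_mem⟩
    have hx' : (φ x).1 = d.edge := congrArg Subtype.val hx
    have huniq : ∀ y, (φ y).1 = d.edge → y = x := fun y hy => hφ (Subtype.ext (hy.trans hx'.symm))
    constructor
    · rintro ⟨y, hy1, hy2⟩ ⟨z, hz1, hz2⟩
      rw [huniq y hy2] at hy1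
      rw [huniq z hz2] at hz1
      exact d.fst_ne_snd (hz1.symm.trans hy1)
    · intro hn
      have hmem := hφv x
      rw [hx'] at hmem
      rcases Sym2.mem_iff.1 hmem with h | h
      · exact absurd ⟨x, h, hx'⟩ hn
      · exact ⟨x, h, hx'⟩
  · rintro i d hd ⟨x, hx, -⟩
    exact x.1.2 i (hx.trans hd)
  · intro v hv
    have hrange : ((fun d : G.Dart => d.edge) '' {d : G.Dart | d.fst = v ∧
        ∃ x, x.1.1 = d.fst ∧ (φ x).1 = d.edge}) =
        Set.range fun i : Fin 2 => (φ (⟨v, hv⟩, i)).1 := by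
      ext e
      simp only [Set.mem_image, Set.mem_ofPred_eq, Set.mem_range]
      constructor
      · rintro ⟨d, ⟨rfl, ⟨⟨w, hw⟩, i⟩, hx1, hx2⟩, rfl⟩
        dsimp only at hx1
        subst hx1
        exact ⟨i, hx2⟩
      · rintro ⟨i, rfl⟩
        obtain ⟨w, hw⟩ := Sym2.mem_iff_exists.1 (hφv (⟨v, hv⟩, i))
        have hadj : G.Adj v w := by
          have := (φ (⟨v, hv⟩, i)).2
          rwa [hw] at this
        exact ⟨⟨(v, w), hadj⟩, ⟨rfl, (⟨v, hv⟩, i), rfl, hw⟩, hw.symm⟩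
    have hinj : Function.Injective fun i : Fin 2 => (φ (⟨v, hv⟩, i)).1 := by
      intro i j h
      exact congrArg Prod.snd (hφ (Subtype.ext h))
    change {d : G.Dart | d.fst = v ∧ ∃ x, x.1.1 = d.fst ∧ (φ x).1 = d.edge}.ncard = 2
    rw [← Set.InjOn.ncard_image (f := fun d : G.Dart => d.edge), hrange, ← Set.image_univ,
      Set.ncard_image_of_injective _ hinj, Set.ncard_univ, Nat.card_fin]
    rintro d ⟨hd, -⟩ e ⟨he, -⟩ h
    rcases (SimpleGraph.dart_edge_eq_iff d e).1 h with h | h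
    · exact h
    · rw [h] at hd
      exact absurd (hd.trans he.symm) e.snd_ne_fst

/-- Some labeling is `0011` in each face and changes along the edges in the prescribed way. -/
theorem IsQuadrangulation.exists_next_rule (hR : R.IsQuadrangulation) {β : V → Fin 2}
    (hβ : IsColouring G β) : ∃ ρ : G.Dart → Fin 2, ∀ d, ρ (R.next d) = ρ d + β d.fst := by
  classical
  have hrep : ∀ f : R.Face, ∃ a, R.face a = f ∧ β a.fst = 0 := by
    intro f
    obtain ⟨a, rfl⟩ := R.face_surjective f
    have hx : ∀ x : Fin 2, x = 0 ∨ x = 1 := by decide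
    rcases hx (β a.fst) with h | h
    · exact ⟨a, rfl, h⟩
    · exact ⟨R.next a, by simp, by rw [next_fst, hβ, h]; rfl⟩
  choose r hr hrβ using hrep
  -- In each face the pattern `0, 0, 1, 1` starts at a dart whose tail has colour `0`.
  refine ⟨fun d => if d = R.next (R.next (r (R.face d))) ∨
    d = R.next (R.next (R.next (r (R.face d)))) then 1 else 0, fun d => ?_⟩
  have hfd := hr (R.face d)
  have hb := hrβ (R.face d)
  beta_reduce
  rw [face_next]
  generalize r (R.face d) = a at *
  have hne := hR.next_pow_ne a
  have h4 := hR.next_pow_four a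
  have hd := hR.eq_of_face_eq hfd
  have hi : ∀ x y, R.next x = R.next y ↔ x = y := fun _ _ => R.next.injective.eq_iff
  have e1 : (a = R.next (R.next a)) ↔ False := by simpa using hne.2.1.symm
  have e2 : (a = R.next (R.next (R.next a))) ↔ False := by simpa using hne.2.2.symm
  have e3 : (a = R.next a) ↔ False := by simpa using hne.1.symm
  rcases hd with rfl | rfl | rfl | rfl
  · simp only [hi, e1, e2, e3, hb]; decide
  · simp only [hi, e1, e3, hb, next_fst, hβ _]; decide
  · simp only [hi, e3, hb, next_fst, hβ _, or_true, true_or, if_true]; decide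
  · simp only [h4, hi, e1, e2, hb, next_fst, hβ _, or_true, or_false, if_true, if_false]; decide

theorem ncard_symmDiff_even {α : Type*} [Finite α] {A B : Set α} (hA : Even A.ncard)
    (hB : Even B.ncard) : Even (symmDiff A B).ncard := by
  have h1 := Set.ncard_inter_add_ncard_sdiff_eq_ncard A B
  have h2 := Set.ncard_inter_add_ncard_sdiff_eq_ncard B A
  have h3 : (symmDiff A B).ncard = (A \ B).ncard + (B \ A).ncard :=
    Set.ncard_union_eq disjoint_sdiff_sdiff
  rw [Set.inter_comm] at h2
  rw [h3]
  rw [← h1] at hA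
  rw [← h2] at hB
  rw [Nat.even_add] at *
  tauto

theorem add_ite_ne_iff (x y z : Fin 2) (p q : Prop) [Decidable p] [Decidable q] :
    ¬ (x + if p then 1 else 0) + z = (y + if q then 1 else 0) + z ↔ Xor (¬ x = y) (Xor p q) := by
  by_cases hp : p <;> by_cases hq : q <;>
    simp only [hp, hq, if_true, if_false, Xor] <;> revert x y z <;> decide

theorem xor_symmDiff_iff (p q : Prop) : Xor p ((p ∧ ¬ q) ∨ (q ∧ ¬ p)) ↔ q := by
  unfold Xor
  tauto

/-- Every orientation with outdegrees `0` and `2` as required is induced by a labeling. -/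
theorem IsQuadrangulation.exists_isAdmissible [Finite V] (hR : R.IsQuadrangulation)
    {β : V → Fin 2} (hβ : IsColouring G β) {s : Fin 2 → V} (hs : s 0 ≠ s 1)
    (hsβ : ∀ i, β (s i) = 1) {outer : R.Face} (houter : R.OnFace (s 0) outer) :
    ∃ ℓ, R.IsAdmissible β s ℓ := by
  classical
  have := Fintype.ofFinite V
  have : Nonempty R.Face := ⟨outer⟩
  obtain ⟨O, hO1, hO2, hO3⟩ := hR.exists_two_orientation hβ hs hsβ
  obtain ⟨ρ, hρ⟩ := hR.exists_next_rule hβ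
  -- The edges on which `ρ` induces the wrong direction are even at each vertex: the outdegrees of
  -- `ρ` are even, and those of `O` are `0` or `2`.
  have hD : IsEvenDartSet (symmDiff {d | ¬ R.Coincide ρ d} O) := by
    refine ⟨fun d => ?_, fun v => ?_⟩
    · simp only [Set.mem_symmDiff, Set.mem_ofPred_eq, coincide_symm_iff_not hβ hρ, hO1]
      tauto
    · have h1 : {d | d ∈ symmDiff {d | ¬ R.Coincide ρ d} O ∧ d.fst = v} =
          symmDiff {d | d.fst = v ∧ ¬ R.Coincide ρ d} {d | d.fst = v ∧ d ∈ O} := by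
        ext d
        simp only [Set.mem_symmDiff, Set.mem_ofPred_eq]
        tauto
      rw [h1]
      refine ncard_symmDiff_even (R.even_outdeg ρ v) ?_
      by_cases hv : ∃ i, v = s i
      · obtain ⟨i, rfl⟩ := hv
        have : {d : G.Dart | d.fst = s i ∧ d ∈ O} = ∅ := by
          rw [Set.eq_empty_iff_forall_notMem]
          rintro d ⟨h2, h3⟩
          exact hO2 i d h2 h3
        rw [this, Set.ncard_empty]
        exact Even.zero
      · rw [not_exists] at hv
        rw [hO3 v hv]
        exact even_two
  obtain ⟨F, hF⟩ := hR.1.exists_boundary_eq hD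
  obtain ⟨a, ha, -⟩ := houter
  -- Complementing on `F` reverses exactly the wrong edges and keeps the local equation. Adding the
  -- constant `ℓ₀ a` afterwards makes the label at `a` zero.
  let ℓ₀ : G.Dart → Fin 2 := fun d => ρ d + if R.face d ∈ F then 1 else 0
  let ℓ : G.Dart → Fin 2 := fun d => ℓ₀ d + ℓ₀ a
  have hco : ∀ d, ¬ R.Coincide ℓ d ↔ d ∈ O := by
    intro d
    have h1 : d ∈ R.boundary F ↔ d ∈ symmDiff {d | ¬ R.Coincide ρ d} O := by rw [hF]
    rw [Set.mem_symmDiff] at h1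
    change Xor (R.face d ∈ F) (R.face d.symm ∈ F) ↔
      ((¬ ρ d = ρ (R.cw.symm d)) ∧ d ∉ O) ∨ (d ∈ O ∧ ¬ ¬ ρ d = ρ (R.cw.symm d)) at h1
    change (¬ (ρ d + if R.face d ∈ F then 1 else 0) + ℓ₀ a =
      (ρ (R.cw.symm d) + if R.face (R.cw.symm d) ∈ F then 1 else 0) + ℓ₀ a) ↔ _
    rw [face_cw_symm, add_ite_ne_iff, h1]
    exact xor_symmDiff_iff _ _
  have hout : ∀ v, R.outdeg ℓ v = {d : G.Dart | d.fst = v ∧ d ∈ O}.ncard := by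
    intro v
    simp only [outdeg, hco]
  refine ⟨ℓ, fun d => ?_, fun i => ?_, fun v hv => ?_, a, ha, ?_⟩
  · change (ρ (R.next d) + if R.face (R.next d) ∈ F then 1 else 0) + ℓ₀ a =
      (ρ d + if R.face d ∈ F then 1 else 0) + ℓ₀ a + β d.fst
    rw [face_next, hρ, add_right_comm (ρ d), add_right_comm]
  · rw [hout, Set.ncard_eq_zero (Set.toFinite _), Set.eq_empty_iff_forall_notMem]
    rintro d ⟨h2, h3⟩
    exact hO2 i d h2 h3
  · rw [hout, hO3 v hv]
  · change ℓ₀ a + ℓ₀ a = 0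
    generalize ℓ₀ a = x
    revert x; decide

end RotationSystem

theorem mainTheorem11 {V : Type*} [Finite V] (G : SimpleGraph V) (R : RotationSystem G)
    (hQ : R.IsQuadrangulation)
    (black white : Set V) (hcover : black ∪ white = Set.univ)
    (hbip : G.IsBipartiteWith black white)
    (outer : R.Face) (s : Fin 2 → V) (hs : s 0 ≠ s 1)
    (hblack : ∀ i, s i ∈ black) (houter : ∀ i, R.OnFace (s i) outer) :
    (∀ ℓ : G.Dart → Fin 2, R.IsStrongLabeling outer s ℓ →
      ∀ (v : V) (C : G.Walk v v), R.IsDirectedCycle ℓ C →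
        R.IsStrongLabeling outer s (R.complementInside outer C ℓ) ∧
        ∀ d : G.Dart, R.Directed (R.complementInside outer C ℓ) d ↔
          (d.edge ∈ C.edges ∧ R.Directed ℓ d.symm) ∨ (d.edge ∉ C.edges ∧ R.Directed ℓ d)) ∧
    (R.flipGraph outer s).Connected
 := by
  classical
  let β : V → Fin 2 := fun v => if v ∈ black then 1 else 0
  have hβ : RotationSystem.IsColouring G β := by
    intro d
    rcases hbip.mem_of_adj d.adj with ⟨h1, h2⟩ | ⟨h1, h2⟩
    · have h3 : d.snd ∉ black := fun h => Set.disjoint_left.1 hbip.disjoint h h2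
      simp only [β, if_pos h1, if_neg h3]
      decide
    · have h3 : d.fst ∉ black := fun h => Set.disjoint_left.1 hbip.disjoint h h1
      simp only [β, if_pos h2, if_neg h3]
      decide
  have hsβ : ∀ i, β (s i) = 1 := fun i => if_pos (hblack i)
  refine ⟨fun ℓ hℓ v C hC => ?_, ?_⟩
  · have hadm := hℓ.isAdmissible hQ hβ (hsβ 0) (houter 0)
    exact ⟨(hadm.complementInside hQ.1 hβ (houter 0) hC).isStrongLabeling hQ hβ hs hsβ houter,
      RotationSystem.directed_complementInside_iff hQ.1 outer hβ hadm.next_rule hC.1⟩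
  · obtain ⟨ℓ, hℓ⟩ := hQ.exists_isAdmissible hβ hs hsβ (houter 0)
    have : Nonempty {ℓ : G.Dart → Fin 2 // R.IsStrongLabeling outer s ℓ} :=
      ⟨⟨ℓ, hℓ.isStrongLabeling hQ hβ hs hsβ houter⟩⟩
    exact ⟨RotationSystem.flipGraph_preconnected hQ hβ hs hsβ houter⟩
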